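/- **Lemma 5.1 (trilinear estimate).** Let $\alpha,\beta\in\mathbb R$ with $\beta\ne 0$, put $p(\xi)=-\beta\xi^5+\alpha\xi^3$ and $\langle r\rangle=1+|r|$, and for $s,b\in\mathbb R$ let $X_{s,b}$ be the completion of $C_0^\infty(\mathbb R\times\mathbb R)$ (complex-valued) under the norm $$\|u\|_{X_{s,b}}^2=\iint\langle\xi\rangle^{2s}\,\langle\tau-p(\xi)\rangle^{2b}\,|\widehat u(\xi,\tau)|^2\,d\xi\,d\tau ,$$ realized as the space of tempered distributions $u$ on $\mathbb R\times\mathbb R$ whose space-time Fourier transform $\widehat u$ is a function for which this quantity is finite. Let $s\ge-\tfrac14$ and $\tfrac12<b\le1$. Then there is a constant $C$, depending only on $\alpha,\beta,s,b$, such that for all $u_1,u_2,u_3\in X_{s,b}$ the following holds: $u_1,u_2,u_3$ are functions on $\mathbb R\times\mathbb R$, their pointwise product $u_1u_2u_3$ is again (a function defining) a tempered distribution, and its distributional derivative in $x$ satisfies $$\|\partial_x(u_1u_2u_3)\|_{X_{s,b-1}}\le C\,\|u_1\|_{X_{s,b}}\,\|u_2\|_{X_{s,b}}\,\|u_3\|_{X_{s,b}}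 .$$ -/

import Mathlib

open scoped SchwartzMap FourierTransform LineDeriv ENNReal NNReal

noncomputable section

namespace Kawahara

/-- The space-time plane; coordinate `0` is the space variable `x`, coordinate `1` is the time
variable `t`. On the Fourier side the same plane carries the dual variables. -/
abbrev Plane : Type := EuclideanSpace ℝ (Fin 2)

/-- The unit vector in the `x` direction. -/
def ex : Plane := EuclideanSpace.single 0 1

/-- The phase `p(ξ) = -β ξ⁵ + α ξ³` of the linear equation `v_t + α v_xxx + β v_xxxxx = 0`. -/
def phase (α β ξ : ℝ) : ℝ := -β * ξ ^ 5 + α * ξ ^ 3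

/-- The bracket `⟨r⟩ = 1 + |r|`. -/
def bracket (r : ℝ) : ℝ := 1 + |r|

/-- The weight `⟨ξ⟩ ^ s * ⟨τ - p(ξ)⟩ ^ b`. -/
def weight (α β s b ξ τ : ℝ) : ℝ :=
  bracket ξ ^ s * bracket (τ - phase α β ξ) ^ b

/-- The tempered distribution `U` is given by integration against the measurable function `f`.
Such an `f` is unique up to null sets. -/
def Represents (f : Plane → ℂ) (U : 𝓢'(Plane, ℂ)) : Prop :=
  MeasureTheory.AEStronglyMeasurable f MeasureTheory.volume ∧
    ∀ g : 𝓢(Plane, ℂ), MeasureTheory.Integrable (fun z ↦ g z * f z) MeasureTheory.volume ∧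
      U g = ∫ z, g z * f z

/-- The `X_{s,b}` norm of a tempered distribution `U`, with value `∞` unless `U` belongs to
`X_{s,b}`: the weighted `L²` norm of the Fourier transform of `U` when the latter is a function
(the infimum is over the representatives of that function, which agree almost everywhere), and
`∞` when it is not.

The Fourier transform `𝓕` has the kernel `exp (-2πi ⟨z, ζ⟩)`, so the angular frequencies, those of
the kernel `exp (-i (x ξ + t τ))`, are `(ξ, τ) = 2π ζ`. The measure is `dζ = dξ dτ / (2π)²`, a
fixed normalization of `dξ dτ`. -/
def bourgainNorm (α β s b : ℝ) (U : 𝓢'(Plane, ℂ)) : ℝ≥0∞ :=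
  ⨅ (F : Plane → ℂ) (_ : Represents F (𝓕 U)),
    MeasureTheory.eLpNorm
      (fun ζ ↦ (weight α β s b (2 * Real.pi * ζ 0) (2 * Real.pi * ζ 1) : ℂ) * F ζ)
      2 MeasureTheory.volume

/-- `U ∈ X_{s,b}`. The tempered distributions with finite norm are the completion of the smooth
compactly supported functions under that norm. -/
def MemBourgain (α β s b : ℝ) (U : 𝓢'(Plane, ℂ)) : Prop :=
  bourgainNorm α β s b U < ∞

end Kawahara

end

noncomputable section

namespace Kawahara

/-! ### Cauchy–Schwarz, duality, and convolutions of nonnegative functions -/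

section

open MeasureTheory

/-! Since `b ≤ 1`, the factor `⟨τ - p(ξ)⟩ ^ (b - 1)` is at most one, and the derivative costs `|ξ| ≤
⟨ξ⟩`. It therefore suffices to bound `⟨ξ⟩ ^ (s + 1)` times the triple convolution of the moduli of
the Fourier transforms in `L²`. Dividing out the weights and pairing with `G` gives a trilinear form
with symbol `⟨ξ₁ + ξ₂ + ξ₃⟩ ^ (s + 1) ∏ ⟨ξⱼ⟩ ^ (-s)`, acting on `L²` functions times `⟨τⱼ - p(ξⱼ)⟩ ^
(-b)`. For `s ≥ -1/4` the symbol is `O(N ^ (3/2))`, with `N ≥ 1` a bound for all three frequencies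
(`kawaharaSymbol_le`). For `b > 1/2` the modulation weights are square integrable, so Cauchy–Schwarz
in the modulations reduces matters to functions carried by the curve `τ = p(ξ)`
(`FreeBound.trilinearBound`).

Fix `R` so large that the quintic term of `p` dominates beyond `R`. Frequencies below `R` are
handled by Cauchy–Schwarz alone (`trilinearBound_low`). If the largest frequency `x` is at least
twice another one `z` in modulus, then `|p'(x) - p'(z)|` is at least a multiple of `x ^ 4`; this is
the Jacobian of `(x, z) ↦ (x + z, p(x) + p(z))`, and it pays for `|x| ^ (3/2)` with `|x| ^ (-1/2)`
left to integrate the third frequency (`freeBound_sep`).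

If all three are comparable, the symbol is distributed as `∏ |ξⱼ| ^ (1/2)`, which is the `L⁶`
Strichartz estimate with gain of derivatives. Reflecting a factor does not change the `L²` norm of a
convolution of nonnegative functions, so all frequencies may be taken positive. There the phase is
convex, and in polar coordinates about the point where the three frequencies coincide the total
phase increases along rays at a rate that controls `r ξ₁ ξ₂ ξ₃` (`lintegral_phase_triple_le`).

The convolution bound with three equal factors also embeds `X_{s,b}` in `L⁶`, so products are
defined pointwise and lie in `L²`. Truncating the Fourier transforms reduces the convolution formula
to integrable functions, and the pointwise bound on the Fourier transform survives the limit
(`ConvolutionBound.exists_product`). -/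

theorem sq_lintegral_mul_le {X : Type*} [MeasurableSpace X] (μ : Measure X) {f g : X → ℝ≥0∞}
    (hf : AEMeasurable f μ) (hg : AEMeasurable g μ) :
    (∫⁻ x, f x * g x ∂μ) ^ 2 ≤ (∫⁻ x, f x ^ 2 ∂μ) * ∫⁻ x, g x ^ 2 ∂μ := by
  have h := ENNReal.lintegral_mul_le_Lp_mul_Lq μ Real.HolderConjugate.two_two hf hg
  simp only [Pi.mul_apply, ENNReal.rpow_two] at h
  calc _ ≤ ((∫⁻ x, f x ^ 2 ∂μ) ^ (1 / 2 : ℝ) * (∫⁻ x, g x ^ 2 ∂μ) ^ (1 / 2 : ℝ)) ^ 2 := by gcongr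
    _ = _ := by
      rw [mul_pow, ← ENNReal.rpow_natCast, ← ENNReal.rpow_natCast, ← ENNReal.rpow_mul,
        ← ENNReal.rpow_mul]
      norm_num

theorem add_sq_le_two_mul (a b : ℝ≥0∞) : (a + b) ^ 2 ≤ 2 * (a ^ 2 + b ^ 2) := by
  have h := ENNReal.rpow_add_le_mul_rpow_add_rpow a b (p := 2) (by norm_num)
  norm_num at h
  simpa using h

/-- Duality: an `L²` bound follows from bounds on all pairings with nonnegative functions. -/
theorem lintegral_sq_le_of_pairing {X : Type*} [MeasurableSpace X] (μ : Measure X) [SigmaFinite μ]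
    {K : X → ℝ≥0∞} (hK : Measurable K) {C : ℝ≥0∞}
    (h : ∀ G : X → ℝ≥0∞, Measurable G → (∫⁻ x, G x * K x ∂μ) ^ 2 ≤ C * ∫⁻ x, G x ^ 2 ∂μ) :
    ∫⁻ x, K x ^ 2 ∂μ ≤ C := by
  -- Testing against `K` itself would require `∫ K ^ 2 < ∞` in order to divide. Truncations of `K`
  -- in height and to sets of finite measure have finite square integral and increase to `K`.
  set G : ℕ → X → ℝ≥0∞ := fun n ↦ (spanningSets μ n).indicator (fun x ↦ min (K x) n)
  have hGm : ∀ n, Measurable (G n) := fun n ↦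
    (hK.min measurable_const).indicator (measurableSet_spanningSets μ n)
  have hle : ∀ n x, G n x ≤ K x := fun n x ↦ by
    by_cases hx : x ∈ spanningSets μ n <;> simp [G, hx]
  have hfin : ∀ n, ∫⁻ x, G n x ^ 2 ∂μ ≠ ∞ := fun n ↦ by
    have : ∫⁻ x, G n x ^ 2 ∂μ ≤ ∫⁻ x in spanningSets μ n, (n : ℝ≥0∞) ^ 2 ∂μ := by
      rw [← lintegral_indicator (measurableSet_spanningSets μ n)]
      refine lintegral_mono fun x ↦ ?_
      by_cases hx : x ∈ spanningSets μ n
      · simp only [G, hx, Set.indicator_of_mem]; gcongr; exact min_le_right _ _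
      · simp [G, hx]
    refine ne_top_of_le_ne_top ?_ this
    rw [setLIntegral_const]
    exact ENNReal.mul_ne_top (by simp) (measure_spanningSets_lt_top μ n).ne
  have hn : ∀ n, ∫⁻ x, G n x ^ 2 ∂μ ≤ C := fun n ↦ by
    have h1 : ∫⁻ x, G n x ^ 2 ∂μ ≤ ∫⁻ x, G n x * K x ∂μ :=
      lintegral_mono fun x ↦ by rw [sq]; gcongr; exact hle n x
    by_cases h0 : ∫⁻ x, G n x ^ 2 ∂μ = 0
    · simp [h0]
    have h2 : (∫⁻ x, G n x ^ 2 ∂μ) * (∫⁻ x, G n x ^ 2 ∂μ) ≤ C * ∫⁻ x, G n x ^ 2 ∂μ := by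
      rw [← sq]
      exact (pow_le_pow_left' h1 2).trans (h _ (hGm n))
    exact (ENNReal.mul_le_mul_iff_left h0 (hfin n)).1 h2
  have hsup : ∀ x, ⨆ n, G n x ^ 2 = K x ^ 2 := fun x ↦ by
    have hmono : Monotone fun n ↦ G n x := fun m n hmn ↦ by
      by_cases hx : x ∈ spanningSets μ m
      · have hx' := monotone_spanningSets μ hmn hx
        simp only [G, hx, hx', Set.indicator_of_mem]
        gcongr
      · simp [G, hx]
    have ht : Filter.Tendsto (fun n ↦ G n x) Filter.atTop (nhds (K x)) := by
      have h1 : Filter.Tendsto (fun n : ℕ ↦ min (K x) (n : ℝ≥0∞)) Filter.atTop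
          (nhds (min (K x) ∞)) :=
        tendsto_const_nhds.min ENNReal.tendsto_nat_nhds_top
      rw [min_eq_left le_top] at h1
      refine h1.congr' ?_
      obtain ⟨N, hN⟩ := Set.mem_iUnion.1 ((iUnion_spanningSets μ).symm ▸ Set.mem_univ x)
      filter_upwards [Filter.eventually_ge_atTop N] with n hn
      simp [G, monotone_spanningSets μ hn hN]
    have h2 : Monotone fun n ↦ G n x ^ 2 := fun m n hmn ↦ pow_le_pow_left' (hmono hmn) 2
    exact tendsto_nhds_unique (tendsto_atTop_iSup h2) (ENNReal.Tendsto.pow ht)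
  calc ∫⁻ x, K x ^ 2 ∂μ = ∫⁻ x, ⨆ n, G n x ^ 2 ∂μ := by simp_rw [hsup]
    _ = ⨆ n, ∫⁻ x, G n x ^ 2 ∂μ := by
      refine lintegral_iSup (fun n ↦ (hGm n).pow_const 2) fun m n hmn x ↦ ?_
      refine pow_le_pow_left' ?_ 2
      by_cases hx : x ∈ spanningSets μ m
      · have hx' := monotone_spanningSets μ hmn hx
        simp only [G, hx, hx', Set.indicator_of_mem]
        gcongr
      · simp [G, hx]
    _ ≤ C := iSup_le hn

section Convolution

variable {V : Type*} [AddCommGroup V] [MeasurableSpace V] [MeasurableAdd₂ V] [MeasurableNeg V]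
  (μ : Measure V)

/-- Reflecting one factor does not change the `L²` norm of a convolution. -/
theorem lintegral_sq_lconvolution_neg [SFinite μ] [μ.IsAddLeftInvariant] [μ.IsNegInvariant]
    {F H : V → ℝ≥0∞} (hF : Measurable F) (hH : Measurable H) :
    ∫⁻ z, (F ⋆ₗ[μ] (fun y ↦ H (-y))) z ^ 2 ∂μ = ∫⁻ z, (F ⋆ₗ[μ] H) z ^ 2 ∂μ := by
  -- Expanding the square leaves only the correlation of two translates of `L`, and this is
  -- unchanged when `L` is reflected.
  have expand : ∀ L : V → ℝ≥0∞, Measurable L → ∫⁻ z, (F ⋆ₗ[μ] L) z ^ 2 ∂μ =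
      ∫⁻ a, ∫⁻ b, F a * F b * ∫⁻ z, L (-a + z) * L (-b + z) ∂μ ∂μ ∂μ := fun L hL ↦ by
    have h1 : ∀ z, (F ⋆ₗ[μ] L) z ^ 2 = ∫⁻ a, ∫⁻ b, F a * L (-a + z) * (F b * L (-b + z)) ∂μ ∂μ := by
      intro z
      rw [sq, lconvolution_def, ← lintegral_mul_const _ (by fun_prop)]
      refine lintegral_congr fun a ↦ ?_
      rw [lintegral_const_mul _ (by fun_prop)]
    simp_rw [h1]
    rw [lintegral_lintegral_swap (by fun_prop)]
    refine lintegral_congr fun a ↦ ?_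
    rw [lintegral_lintegral_swap (by fun_prop)]
    refine lintegral_congr fun b ↦ ?_
    rw [← lintegral_const_mul _ (by fun_prop)]
    refine lintegral_congr fun z ↦ ?_
    ring
  rw [expand _ hH, expand _ (by fun_prop)]
  refine lintegral_congr fun a ↦ lintegral_congr fun b ↦ ?_
  congr 1
  -- The substitution `z ↦ a + b - z` turns `H (a - z) * H (b - z)` into `H (z - b) * H (z - a)`.
  rw [← lintegral_add_left_eq_self _ (a + b), ← lintegral_neg_eq_self]
  refine lintegral_congr fun z ↦ ?_
  rw [mul_comm]
  congr 2 <;> abel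

theorem lconvolution_add_left {F F' H : V → ℝ≥0∞} (hF : Measurable F) (hH : Measurable H) :
    (fun z ↦ F z + F' z) ⋆ₗ[μ] H = fun z ↦ (F ⋆ₗ[μ] H) z + (F' ⋆ₗ[μ] H) z := by
  ext z
  simp only [lconvolution_def, add_mul]
  rw [lintegral_add_left (by fun_prop)]

theorem lintegral_mul_lconvolution [SFinite μ] [μ.IsAddLeftInvariant]
    {G F₁ F₂ F₃ : V → ℝ≥0∞} (hG : Measurable G)
    (h₁ : Measurable F₁) (h₂ : Measurable F₂) (h₃ : Measurable F₃) :
    ∫⁻ z, G z * (F₁ ⋆ₗ[μ] (F₂ ⋆ₗ[μ] F₃)) z ∂μ =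
      ∫⁻ a, ∫⁻ b, ∫⁻ c, G (a + b + c) * (F₁ a * F₂ b * F₃ c) ∂μ ∂μ ∂μ := by
  have h : ∀ z, G z * (F₁ ⋆ₗ[μ] (F₂ ⋆ₗ[μ] F₃)) z =
      ∫⁻ a, ∫⁻ b, G z * (F₁ a * F₂ b * F₃ (-b + (-a + z))) ∂μ ∂μ := fun z ↦ by
    rw [lconvolution_def, ← lintegral_const_mul _ (by fun_prop)]
    refine lintegral_congr fun a ↦ ?_
    rw [lconvolution_def, ← lintegral_const_mul _ (by fun_prop),
      ← lintegral_const_mul _ (by fun_prop)]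
    refine lintegral_congr fun b ↦ ?_
    ring
  simp_rw [h]
  rw [lintegral_lintegral_swap (by fun_prop)]
  refine lintegral_congr fun a ↦ ?_
  rw [lintegral_lintegral_swap (by fun_prop)]
  refine lintegral_congr fun b ↦ ?_
  rw [← lintegral_add_left_eq_self _ (a + b)]
  refine lintegral_congr fun c ↦ ?_
  congr 3
  abel

end Convolution

end

/-! ### Transference from free solutions, and bounded frequencies -/

section

open MeasureTheory

/-- The trilinear form on the Fourier side, tested against `G`, with a symbol `M` depending on
the three spatial frequencies. -/
def trilinearForm (M : ℝ × ℝ × ℝ → ℝ≥0∞) (G F₁ F₂ F₃ : ℝ × ℝ → ℝ≥0∞) : ℝ≥0∞ :=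
  ∫⁻ a : ℝ × ℝ, ∫⁻ b : ℝ × ℝ, ∫⁻ c : ℝ × ℝ,
    M (a.1, b.1, c.1) * G (a + b + c) * (F₁ a * F₂ b * F₃ c)

/-- The weight `⟨τ - p(ξ)⟩ ^ (-b)`. -/
def modWeight (α β b : ℝ) (z : ℝ × ℝ) : ℝ≥0∞ :=
  ENNReal.ofReal (bracket (z.2 - phase α β z.1) ^ (-b))

/-- The trilinear form with symbol `M` is bounded on functions with modulation weight. -/
def TrilinearBound (α β b : ℝ) (M : ℝ × ℝ × ℝ → ℝ≥0∞) : Prop :=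
  ∃ C : ℝ≥0, ∀ G F₁ F₂ F₃ : ℝ × ℝ → ℝ≥0∞, Measurable G → Measurable F₁ → Measurable F₂ →
    Measurable F₃ →
    (trilinearForm M G (fun z ↦ modWeight α β b z * F₁ z) (fun z ↦ modWeight α β b z * F₂ z)
      (fun z ↦ modWeight α β b z * F₃ z)) ^ 2 ≤
      C * (∫⁻ z, G z ^ 2) * ((∫⁻ z, F₁ z ^ 2) * (∫⁻ z, F₂ z ^ 2) * ∫⁻ z, F₃ z ^ 2)

/-- The trilinear form with symbol `M`, restricted to free solutions, is bounded. -/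
def FreeBound (α β : ℝ) (M : ℝ × ℝ × ℝ → ℝ≥0∞) : Prop :=
  ∃ C : ℝ≥0, ∀ (G : ℝ × ℝ → ℝ≥0∞) (f₁ f₂ f₃ : ℝ → ℝ≥0∞), Measurable G → Measurable f₁ →
    Measurable f₂ → Measurable f₃ →
    (∫⁻ x, ∫⁻ y, ∫⁻ z, M (x, y, z) *
      G (x + y + z, phase α β x + phase α β y + phase α β z) * (f₁ x * f₂ y * f₃ z)) ^ 2 ≤
      C * (∫⁻ z, G z ^ 2) * ((∫⁻ x, f₁ x ^ 2) * (∫⁻ x, f₂ x ^ 2) * ∫⁻ x, f₃ x ^ 2)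

@[fun_prop]
theorem measurable_phase (α β : ℝ) : Measurable (phase α β) := by
  unfold phase; fun_prop

theorem bracket_pos (r : ℝ) : 0 < bracket r := by unfold bracket; positivity

theorem one_le_bracket (r : ℝ) : 1 ≤ bracket r := by unfold bracket; simp

@[fun_prop]
theorem measurable_bracket : Measurable bracket := by
  unfold bracket; fun_prop

@[fun_prop]
theorem measurable_modWeight (α β b : ℝ) : Measurable (modWeight α β b) := by
  unfold modWeight; fun_prop

variable {α β b : ℝ} {M M' : ℝ × ℝ × ℝ → ℝ≥0∞}

theorem TrilinearBound.mono (h : TrilinearBound α β b M') (hM' : Measurable M') (c : ℝ≥0)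
    (hM : ∀ p, M p ≤ c * M' p) : TrilinearBound α β b M := by
  obtain ⟨C, hC⟩ := h
  refine ⟨c ^ 2 * C, fun G F₁ F₂ F₃ hG h₁ h₂ h₃ ↦ ?_⟩
  have : trilinearForm M G (fun z ↦ modWeight α β b z * F₁ z)
      (fun z ↦ modWeight α β b z * F₂ z) (fun z ↦ modWeight α β b z * F₃ z) ≤
      c * trilinearForm M' G (fun z ↦ modWeight α β b z * F₁ z)
      (fun z ↦ modWeight α β b z * F₂ z) (fun z ↦ modWeight α β b z * F₃ z) := by
    unfold trilinearForm
    rw [← lintegral_const_mul _ (by fun_prop)]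
    refine lintegral_mono fun x ↦ ?_
    rw [← lintegral_const_mul _ (by fun_prop)]
    refine lintegral_mono fun y ↦ ?_
    rw [← lintegral_const_mul _ (by fun_prop)]
    refine lintegral_mono fun z ↦ ?_
    simp only [← mul_assoc]
    gcongr
    exact hM _
  calc _ ≤ _ := pow_le_pow_left' this 2
    _ ≤ _ := by
      rw [mul_pow, ENNReal.coe_mul, ENNReal.coe_pow, mul_assoc, mul_assoc, ← mul_assoc (C : ℝ≥0∞)]
      gcongr
      exact hC G F₁ F₂ F₃ hG h₁ h₂ h₃

theorem TrilinearBound.add (h : TrilinearBound α β b M) (h' : TrilinearBound α β b M')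
    (hM : Measurable M) : TrilinearBound α β b (fun p ↦ M p + M' p) := by
  obtain ⟨C, hC⟩ := h
  obtain ⟨C', hC'⟩ := h'
  refine ⟨2 * (C + C'), fun G F₁ F₂ F₃ hG h₁ h₂ h₃ ↦ ?_⟩
  have : trilinearForm (fun p ↦ M p + M' p) G (fun z ↦ modWeight α β b z * F₁ z)
      (fun z ↦ modWeight α β b z * F₂ z) (fun z ↦ modWeight α β b z * F₃ z) =
      trilinearForm M G (fun z ↦ modWeight α β b z * F₁ z)
      (fun z ↦ modWeight α β b z * F₂ z) (fun z ↦ modWeight α β b z * F₃ z) +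
      trilinearForm M' G (fun z ↦ modWeight α β b z * F₁ z)
      (fun z ↦ modWeight α β b z * F₂ z) (fun z ↦ modWeight α β b z * F₃ z) := by
    unfold trilinearForm
    rw [← lintegral_add_left (by fun_prop)]
    refine lintegral_congr fun x ↦ ?_
    rw [← lintegral_add_left (by fun_prop)]
    refine lintegral_congr fun y ↦ ?_
    rw [← lintegral_add_left (by fun_prop)]
    refine lintegral_congr fun z ↦ ?_
    ring
  rw [this]
  refine (add_sq_le_two_mul _ _).trans ?_
  calc _ ≤ 2 * (C * (∫⁻ z, G z ^ 2) * ((∫⁻ z, F₁ z ^ 2) * (∫⁻ z, F₂ z ^ 2) * ∫⁻ z, F₃ z ^ 2) +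
        C' * (∫⁻ z, G z ^ 2) * ((∫⁻ z, F₁ z ^ 2) * (∫⁻ z, F₂ z ^ 2) * ∫⁻ z, F₃ z ^ 2)) := by
        gcongr
        · exact hC G F₁ F₂ F₃ hG h₁ h₂ h₃
        · exact hC' G F₁ F₂ F₃ hG h₁ h₂ h₃
    _ = _ := by push_cast; ring

theorem TrilinearBound.swap_left (h : TrilinearBound α β b M) (hM : Measurable M) :
    TrilinearBound α β b (fun p ↦ M (p.2.1, p.1, p.2.2)) := by
  obtain ⟨C, hC⟩ := h
  refine ⟨C, fun G F₁ F₂ F₃ hG h₁ h₂ h₃ ↦ ?_⟩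
  convert hC G F₂ F₁ F₃ hG h₂ h₁ h₃ using 2
  · unfold trilinearForm
    rw [lintegral_lintegral_swap (by fun_prop)]
    refine lintegral_congr fun x ↦ lintegral_congr fun y ↦ lintegral_congr fun z ↦ ?_
    rw [add_comm y x, mul_comm (modWeight α β b y * F₁ y)]
  · ring

theorem TrilinearBound.swap_right (h : TrilinearBound α β b M) (hM : Measurable M) :
    TrilinearBound α β b (fun p ↦ M (p.1, p.2.2, p.2.1)) := by
  obtain ⟨C, hC⟩ := h
  refine ⟨C, fun G F₁ F₂ F₃ hG h₁ h₂ h₃ ↦ ?_⟩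
  convert hC G F₁ F₃ F₂ hG h₁ h₃ h₂ using 2
  · unfold trilinearForm
    refine lintegral_congr fun x ↦ ?_
    rw [lintegral_lintegral_swap (by fun_prop)]
    refine lintegral_congr fun y ↦ lintegral_congr fun z ↦ ?_
    rw [add_right_comm x z y, mul_right_comm (modWeight α β b x * F₁ x)]
  · ring

/-- The plane is foliated by the vertical translates of the curve `τ = p(ξ)`; the modulation `σ`
labels the leaf. -/
theorem lintegral_eq_lintegral_shear {H : ℝ × ℝ → ℝ≥0∞} (hH : Measurable H) :
    ∫⁻ z, H z = ∫⁻ σ, ∫⁻ ξ, H (ξ, phase α β ξ + σ) := by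
  rw [Measure.volume_eq_prod, lintegral_prod _ hH.aemeasurable,
    lintegral_lintegral_swap (f := fun σ ξ ↦ H (ξ, phase α β ξ + σ)) (by fun_prop)]
  exact lintegral_congr fun ξ ↦ (lintegral_add_left_eq_self (fun τ ↦ H (ξ, τ)) _).symm

theorem trilinearForm_eq_shear (hM : Measurable M) {G F₁ F₂ F₃ : ℝ × ℝ → ℝ≥0∞}
    (hG : Measurable G) (h₁ : Measurable F₁) (h₂ : Measurable F₂) (h₃ : Measurable F₃) :
    trilinearForm M G F₁ F₂ F₃ = ∫⁻ r, ∫⁻ x, ∫⁻ s, ∫⁻ y, ∫⁻ t, ∫⁻ z,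
      M (x, y, z) * G (x + y + z, (phase α β x + r) + (phase α β y + s) + (phase α β z + t)) *
        (F₁ (x, phase α β x + r) * F₂ (y, phase α β y + s) * F₃ (z, phase α β z + t)) := by
  unfold trilinearForm
  rw [lintegral_eq_lintegral_shear (α := α) (β := β) (by fun_prop)]
  refine lintegral_congr fun r ↦ lintegral_congr fun x ↦ ?_
  rw [lintegral_eq_lintegral_shear (α := α) (β := β) (by fun_prop)]
  refine lintegral_congr fun s ↦ lintegral_congr fun y ↦ ?_
  rw [lintegral_eq_lintegral_shear (α := α) (β := β) (by fun_prop)]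
  rfl

theorem integrable_bracket_rpow {c : ℝ} (hc : 1 < c) : Integrable fun r ↦ bracket r ^ (-c) := by
  simpa [bracket] using integrable_one_add_norm (E := ℝ) (μ := volume) (r := c) (by simpa using hc)

/-- The squared `L²` norm of `⟨r⟩ ^ (-b)`, which is finite for `b > 1 / 2`. -/
theorem lintegral_bracket_rpow_sq_lt_top (hb : 1 / 2 < b) :
    ∫⁻ r : ℝ, ENNReal.ofReal (bracket r ^ (-b)) ^ 2 < ∞ := by
  have h := (integrable_bracket_rpow (c := 2 * b) (by linarith)).lintegral_lt_top
  refine (lintegral_congr fun r ↦ ?_).trans_lt h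
  rw [← ENNReal.ofReal_pow (Real.rpow_nonneg (bracket_pos r).le _), ← Real.rpow_natCast,
    ← Real.rpow_mul (bracket_pos r).le]
  congr 2
  push_cast
  ring

theorem const_mul_lintegral_mul_lintegral_mul_lintegral {X : Type*} [MeasurableSpace X]
    {μ : Measure X} (c : ℝ≥0∞) {f g h : X → ℝ≥0∞} (hf : Measurable f) (hg : Measurable g)
    (hh : Measurable h) :
    c * ((∫⁻ x, f x ∂μ) * (∫⁻ x, g x ∂μ) * ∫⁻ x, h x ∂μ) =
      ∫⁻ x, ∫⁻ y, ∫⁻ z, c * (f x * g y * h z) ∂μ ∂μ ∂μ := by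
  rw [mul_assoc, ← lintegral_mul_const _ hf, ← lintegral_const_mul _ (by fun_prop)]
  refine lintegral_congr fun x ↦ ?_
  rw [← lintegral_mul_const _ hg, ← lintegral_const_mul _ (by fun_prop),
    ← lintegral_const_mul _ (by fun_prop)]
  refine lintegral_congr fun y ↦ ?_
  rw [← lintegral_const_mul _ hh, ← lintegral_const_mul _ (by fun_prop),
    ← lintegral_const_mul _ (by fun_prop)]
  refine lintegral_congr fun z ↦ ?_
  ring

/-- Transference: bounds for free solutions imply bounds in spaces with a modulation weight. -/
theorem FreeBound.trilinearBound (h : FreeBound α β M) (hM : Measurable M) (hb : 1 / 2 < b) :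
    TrilinearBound α β b M := by
  obtain ⟨C, hC⟩ := h
  set w : ℝ → ℝ≥0∞ := fun r ↦ ENNReal.ofReal (bracket r ^ (-b)) with hw
  have hwm : Measurable w := by fun_prop
  set A : ℝ≥0∞ := ∫⁻ r, w r ^ 2 with hA
  have hAt : A ≠ ∞ := (lintegral_bracket_rpow_sq_lt_top hb).ne
  refine ⟨C * A.toNNReal ^ 3, fun G F₁ F₂ F₃ hG h₁ h₂ h₃ ↦ ?_⟩
  have hmod : ∀ x r, modWeight α β b (x, phase α β x + r) = w r := fun x r ↦ by
    simp [modWeight, hw]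
  rw [trilinearForm_eq_shear (α := α) (β := β) hM hG (by fun_prop) (by fun_prop) (by fun_prop)]
  simp only [hmod]
  -- `q F r` is the squared `L²` norm of `F` on the leaf of modulation `r`.
  set q : (ℝ × ℝ → ℝ≥0∞) → ℝ → ℝ≥0∞ := fun F r ↦ ∫⁻ x, F (x, phase α β x + r) ^ 2 with hq
  have hqm : ∀ F, Measurable F → Measurable (q F) := fun F hF ↦ by fun_prop
  have hq1 := hqm _ h₁
  have hq2 := hqm _ h₂
  have hq3 := hqm _ h₃
  have hqi : ∀ F, Measurable F → ∫⁻ r, q F r = ∫⁻ z, F z ^ 2 := fun F hF ↦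
    (lintegral_eq_lintegral_shear (H := fun z ↦ F z ^ 2) (by fun_prop)).symm
  set D : ℝ≥0∞ := C * ∫⁻ z, G z ^ 2 with hD
  have hGs : ∀ c : ℝ, ∫⁻ z : ℝ × ℝ, G (z.1, z.2 + c) ^ 2 = ∫⁻ z, G z ^ 2 := fun c ↦ by
    have := lintegral_add_right_eq_self (μ := (volume : Measure (ℝ × ℝ))) (fun z ↦ G z ^ 2) (0, c)
    rw [← this]
    refine lintegral_congr fun z ↦ ?_
    congr 2
    ext <;> simp
  -- With the three modulations frozen, the free bound applies to `G` translated in time frequency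
  -- by `r + s + t`, which has the same `L²` norm.
  have inner : ∀ r s t, ∫⁻ x, ∫⁻ y, ∫⁻ z,
      M (x, y, z) * G (x + y + z, (phase α β x + r) + (phase α β y + s) + (phase α β z + t)) *
        (w r * F₁ (x, phase α β x + r) * (w s * F₂ (y, phase α β y + s)) *
          (w t * F₃ (z, phase α β z + t))) ≤
      D ^ (1 / 2 : ℝ) * ((w r * q F₁ r ^ (1 / 2 : ℝ)) * (w s * q F₂ s ^ (1 / 2 : ℝ)) *
        (w t * q F₃ t ^ (1 / 2 : ℝ))) := by
    intro r s t
    have key := hC (fun z ↦ G (z.1, z.2 + (r + s + t))) (fun x ↦ w r * F₁ (x, phase α β x + r))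
      (fun x ↦ w s * F₂ (x, phase α β x + s)) (fun x ↦ w t * F₃ (x, phase α β x + t))
      (by fun_prop) (by fun_prop) (by fun_prop) (by fun_prop)
    simp only [hGs, mul_pow] at key
    rw [lintegral_const_mul _ (by fun_prop), lintegral_const_mul _ (by fun_prop),
      lintegral_const_mul _ (by fun_prop)] at key
    have key2 := ENNReal.rpow_le_rpow key (by norm_num : (0 : ℝ) ≤ 1 / 2)
    rw [← ENNReal.rpow_natCast, ← ENNReal.rpow_mul] at key2
    norm_num only [Nat.cast_ofNat, ENNReal.rpow_one, mul_one] at key2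
    convert key2 using 1
    · refine lintegral_congr fun x ↦ lintegral_congr fun y ↦ lintegral_congr fun z ↦ ?_
      congr 4
      ring
    · simp only [ENNReal.mul_rpow_of_nonneg _ _ (by norm_num : (0 : ℝ) ≤ 1 / 2),
        ← ENNReal.rpow_natCast, ← ENNReal.rpow_mul, hD, hq]
      norm_num
  -- Summing over modulations uses that `⟨r⟩ ^ (-b)` is square integrable, that is, `b > 1 / 2`.
  have hone : ∀ F, Measurable F → (∫⁻ r, w r * q F r ^ (1 / 2 : ℝ)) ^ 2 ≤ A * ∫⁻ z, F z ^ 2 := by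
    intro F hF
    have := hqm _ hF
    have h1 := sq_lintegral_mul_le volume (f := w) (g := fun r ↦ q F r ^ (1 / 2 : ℝ))
      (by fun_prop) (by fun_prop)
    refine h1.trans (le_of_eq ?_)
    rw [← hqi F hF]
    congr 1
    refine lintegral_congr fun r ↦ ?_
    rw [← ENNReal.rpow_natCast, ← ENNReal.rpow_mul]
    norm_num
  have outer : ∫⁻ r, ∫⁻ x, ∫⁻ s, ∫⁻ y, ∫⁻ t, ∫⁻ z,
      M (x, y, z) * G (x + y + z, (phase α β x + r) + (phase α β y + s) + (phase α β z + t)) *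
        (w r * F₁ (x, phase α β x + r) * (w s * F₂ (y, phase α β y + s)) *
          (w t * F₃ (z, phase α β z + t))) ≤
      D ^ (1 / 2 : ℝ) * ((∫⁻ r, w r * q F₁ r ^ (1 / 2 : ℝ)) * (∫⁻ r, w r * q F₂ r ^ (1 / 2 : ℝ)) *
        ∫⁻ r, w r * q F₃ r ^ (1 / 2 : ℝ)) := by
    have e1 : ∀ r x s, ∫⁻ y, ∫⁻ t, ∫⁻ z,
      M (x, y, z) * G (x + y + z, (phase α β x + r) + (phase α β y + s) + (phase α β z + t)) *
        (w r * F₁ (x, phase α β x + r) * (w s * F₂ (y, phase α β y + s)) *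
          (w t * F₃ (z, phase α β z + t))) = ∫⁻ t, ∫⁻ y, ∫⁻ z,
      M (x, y, z) * G (x + y + z, (phase α β x + r) + (phase α β y + s) + (phase α β z + t)) *
        (w r * F₁ (x, phase α β x + r) * (w s * F₂ (y, phase α β y + s)) *
          (w t * F₃ (z, phase α β z + t))) := fun r x s ↦
      lintegral_lintegral_swap (by fun_prop)
    simp only [e1]
    rw [const_mul_lintegral_mul_lintegral_mul_lintegral _ (by fun_prop) (by fun_prop)
      (by fun_prop)]
    refine lintegral_mono fun r ↦ ?_
    rw [lintegral_lintegral_swap (by fun_prop)]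
    refine lintegral_mono fun s ↦ ?_
    rw [lintegral_lintegral_swap (by fun_prop)]
    exact lintegral_mono fun t ↦ inner r s t
  calc _ ≤ _ := pow_le_pow_left' outer 2
    _ = D * ((∫⁻ r, w r * q F₁ r ^ (1 / 2 : ℝ)) ^ 2 * (∫⁻ r, w r * q F₂ r ^ (1 / 2 : ℝ)) ^ 2 *
        (∫⁻ r, w r * q F₃ r ^ (1 / 2 : ℝ)) ^ 2) := by
      rw [mul_pow, mul_pow, mul_pow]
      congr 1
      rw [← ENNReal.rpow_natCast, ← ENNReal.rpow_mul]
      norm_num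
    _ ≤ D * ((A * ∫⁻ z, F₁ z ^ 2) * (A * ∫⁻ z, F₂ z ^ 2) * (A * ∫⁻ z, F₃ z ^ 2)) := by
      gcongr
      · exact hone _ h₁
      · exact hone _ h₂
      · exact hone _ h₃
    _ = _ := by
      rw [hD, ENNReal.coe_mul, ENNReal.coe_pow, ENNReal.coe_toNNReal hAt]
      ring

/-- Bounded spatial frequencies are harmless. -/
theorem trilinearBound_low (α β : ℝ) (hb : 1 / 2 < b) (R : ℝ) :
    TrilinearBound α β b (Set.indicator {p | |p.1| ≤ R ∧ |p.2.1| ≤ R ∧ |p.2.2| ≤ R} 1) := by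
  set w : ℝ → ℝ≥0∞ := fun r ↦ ENNReal.ofReal (bracket r ^ (-b)) with hw
  have hwm : Measurable w := by fun_prop
  set A : ℝ≥0∞ := ∫⁻ r, w r ^ 2 with hA
  have hAt : A ≠ ∞ := (lintegral_bracket_rpow_sq_lt_top hb).ne
  set e : ℝ × ℝ → ℝ≥0∞ := fun z ↦ Set.indicator {x : ℝ | |x| ≤ R} 1 z.1 * modWeight α β b z with he
  have hset : MeasurableSet {x : ℝ | |x| ≤ R} := measurableSet_le (by fun_prop) (by fun_prop)
  have hem : Measurable e := by
    refine Measurable.mul ?_ (by fun_prop)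
    exact (measurable_one.indicator hset).comp measurable_fst
  -- The modulation weight cut off to `|ξ| ≤ R` is in `L²` of the plane. Hence the first two factors
  -- are integrable by Cauchy–Schwarz, while the third is paired with a translate of `G`.
  set B : ℝ≥0∞ := ∫⁻ z, e z ^ 2 with hB
  have hBt : B ≠ ∞ := by
    have : B = ENNReal.ofReal (2 * R) * A := by
      rw [hB, lintegral_eq_lintegral_shear (α := α) (β := β) (by fun_prop), hA, mul_comm,
        ← lintegral_mul_const _ (by fun_prop)]
      refine lintegral_congr fun r ↦ ?_
      have h1 : ∀ x, e (x, phase α β x + r) ^ 2 =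
          w r ^ 2 * Set.indicator {x : ℝ | |x| ≤ R} 1 x := fun x ↦ by
        by_cases hx : |x| ≤ R <;> simp [he, hx, modWeight, hw]
      simp_rw [h1]
      rw [lintegral_const_mul _ (measurable_one.indicator hset), lintegral_indicator_one hset]
      congr 1
      have : {x : ℝ | |x| ≤ R} = Set.Icc (-R) R := by ext x; simp [abs_le]
      rw [this, Real.volume_Icc]
      congr 1
      ring
    rw [this]
    exact ENNReal.mul_ne_top ENNReal.ofReal_ne_top hAt
  have hwle : ∀ z, modWeight α β b z ≤ 1 := fun z ↦ by
    unfold modWeight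
    rw [ENNReal.ofReal_le_one]
    exact Real.rpow_le_one_of_one_le_of_nonpos (one_le_bracket _) (by linarith)
  refine ⟨B.toNNReal ^ 2, fun G F₁ F₂ F₃ hG h₁ h₂ h₃ ↦ ?_⟩
  set X : ℝ≥0∞ := (∫⁻ z, G z ^ 2) * ∫⁻ z, F₃ z ^ 2 with hX
  have inner : ∀ a b' : ℝ × ℝ, ∫⁻ c, G (a + b' + c) * F₃ c ≤ X ^ (1 / 2 : ℝ) := fun a b' ↦ by
    have h1 := sq_lintegral_mul_le volume (f := fun c ↦ G (a + b' + c)) (g := F₃)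
      (by fun_prop) (by fun_prop)
    rw [lintegral_add_left_eq_self (fun z ↦ G z ^ 2)] at h1
    have h2 := ENNReal.rpow_le_rpow h1 (by norm_num : (0 : ℝ) ≤ 1 / 2)
    rw [← ENNReal.rpow_natCast, ← ENNReal.rpow_mul] at h2
    norm_num only [Nat.cast_ofNat, ENNReal.rpow_one, mul_one] at h2
    exact h2
  have hle : trilinearForm (Set.indicator {p | |p.1| ≤ R ∧ |p.2.1| ≤ R ∧ |p.2.2| ≤ R} 1) G
      (fun z ↦ modWeight α β b z * F₁ z) (fun z ↦ modWeight α β b z * F₂ z)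
      (fun z ↦ modWeight α β b z * F₃ z) ≤
      (∫⁻ a, e a * F₁ a) * (∫⁻ a, e a * F₂ a) * X ^ (1 / 2 : ℝ) := by
    unfold trilinearForm
    rw [mul_assoc, ← lintegral_mul_const _ (by fun_prop)]
    refine lintegral_mono fun a ↦ ?_
    rw [← lintegral_mul_const _ (by fun_prop), ← lintegral_const_mul _ (by fun_prop)]
    refine lintegral_mono fun b' ↦ ?_
    refine le_trans ?_ (mul_le_mul_right (mul_le_mul_right (inner a b') _) _)
    rw [← lintegral_const_mul _ (by fun_prop), ← lintegral_const_mul _ (by fun_prop)]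
    refine lintegral_mono fun c ↦ ?_
    by_cases hp : |a.1| ≤ R ∧ |b'.1| ≤ R ∧ |c.1| ≤ R
    · simp only [he, hp, Set.indicator_of_mem, Set.mem_ofPred_eq, and_self, Pi.one_apply, one_mul]
      calc _ ≤ G (a + b' + c) * (modWeight α β b a * F₁ a * (modWeight α β b b' * F₂ b') *
            (1 * F₃ c)) := by gcongr; exact hwle c
        _ = _ := by ring
    · rw [Set.indicator_of_notMem (by simpa using hp)]
      simp
  calc _ ≤ _ := pow_le_pow_left' hle 2
    _ = (∫⁻ a, e a * F₁ a) ^ 2 * (∫⁻ a, e a * F₂ a) ^ 2 * X := by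
      rw [mul_pow, mul_pow]
      congr 1
      rw [← ENNReal.rpow_natCast, ← ENNReal.rpow_mul]
      norm_num
    _ ≤ (B * ∫⁻ z, F₁ z ^ 2) * (B * ∫⁻ z, F₂ z ^ 2) * X := by
      gcongr
      · exact sq_lintegral_mul_le volume (by fun_prop) (by fun_prop)
      · exact sq_lintegral_mul_le volume (by fun_prop) (by fun_prop)
    _ = _ := by
      rw [hX, ENNReal.coe_pow, ENNReal.coe_toNNReal hBt]
      ring

end

/-! ### Separated frequencies: the bilinear change of variables -/

section

open MeasureTheory

/-- The derivative of the phase. -/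
def dphase (α β ξ : ℝ) : ℝ := -5 * β * ξ ^ 4 + 3 * α * ξ ^ 2

theorem hasDerivAt_phase (α β ξ : ℝ) : HasDerivAt (phase α β) (dphase α β ξ) ξ := by
  have h := ((hasDerivAt_pow 5 ξ).const_mul (-β)).add ((hasDerivAt_pow 3 ξ).const_mul α)
  exact h.congr_deriv (by simp only [dphase]; push_cast; ring)

@[fun_prop]
theorem measurable_dphase (α β : ℝ) : Measurable (dphase α β) := by
  unfold dphase; fun_prop

theorem lintegral_triple {H : ℝ × ℝ × ℝ → ℝ≥0∞} (hH : Measurable H) :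
    ∫⁻ p, H p = ∫⁻ x, ∫⁻ y, ∫⁻ z, H (x, y, z) := by
  rw [Measure.volume_eq_prod, lintegral_prod _ hH.aemeasurable]
  refine lintegral_congr fun x ↦ ?_
  rw [Measure.volume_eq_prod, lintegral_prod _ (by fun_prop)]

/-- Change of variables onto the image of `s`, which is then enlarged to the whole line. -/
theorem setLIntegral_deriv_mul_comp_le {s : Set ℝ} (hs : MeasurableSet s) {q q' : ℝ → ℝ}
    (hq : ∀ x ∈ s, HasDerivAt q (q' x) x) (hi : Set.InjOn q s) (h : ℝ → ℝ≥0∞) :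
    ∫⁻ x in s, ENNReal.ofReal |q' x| * h (q x) ≤ ∫⁻ x, h x := by
  rw [← lintegral_image_eq_lintegral_abs_deriv_mul hs (fun x hx ↦ (hq x hx).hasDerivWithinAt) hi]
  exact setLIntegral_le_lintegral _ _

/-- The difference of the two total phases factors as `(x - y) (x + y - u) u (3 α - 5 β T)`, where
`T` is the mean of the two sums of squares. Since `T ≥ ρ`, the last factor cannot vanish. -/
theorem phase_add_phase_sub_inj {α β ρ u x y : ℝ} (hρ : 3 * |α| < 5 * |β| * ρ) (hu : u ≠ 0)
    (hx : ρ ≤ x ^ 2 + (u - x) ^ 2) (hy : ρ ≤ y ^ 2 + (u - y) ^ 2)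
    (h : phase α β x + phase α β (u - x) = phase α β y + phase α β (u - y)) :
    (x - y) * (x + y - u) = 0 := by
  have h1 : (x - y) * (x + y - u) * (u * (-5 * β *
      ((x ^ 2 + (u - x) ^ 2) + (y ^ 2 + (u - y) ^ 2)) / 2 + 3 * α)) = 0 := by
    unfold phase at h; linear_combination h
  rcases mul_eq_zero.1 h1 with h2 | h2
  · exact h2
  · exfalso
    rcases mul_eq_zero.1 h2 with h3 | h3
    · exact hu h3
    · set T := ((x ^ 2 + (u - x) ^ 2) + (y ^ 2 + (u - y) ^ 2)) / 2 with hT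
      have hTρ : ρ ≤ T := by rw [hT]; linarith
      have hT0 : 0 ≤ T := by rw [hT]; positivity
      have h4 : 3 * α = 5 * β * T := by rw [hT]; linarith
      have h5 : 3 * |α| = 5 * |β| * T := by
        have := congrArg abs h4
        simpa [abs_mul, abs_of_nonneg hT0] using this
      nlinarith [abs_nonneg β]

/-- For fixed sum of two frequencies, the total phase is at most two-to-one away from the
origin. -/
theorem lintegral_phase_pair_fiber_le {α β ρ u : ℝ} (hρ : 3 * |α| < 5 * |β| * ρ) (hu : u ≠ 0)
    (h : ℝ → ℝ≥0∞) :
    ∫⁻ x in {x | ρ ≤ x ^ 2 + (u - x) ^ 2}, ENNReal.ofReal |dphase α β x - dphase α β (u - x)| *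
      h (phase α β x + phase α β (u - x)) ≤ 2 * ∫⁻ v, h v := by
  set q : ℝ → ℝ := fun x ↦ phase α β x + phase α β (u - x)
  set q' : ℝ → ℝ := fun x ↦ dphase α β x - dphase α β (u - x)
  have hq : ∀ x, HasDerivAt q (q' x) x := fun x ↦ by
    have h1 := (hasDerivAt_phase α β (u - x)).comp x ((hasDerivAt_id x).const_sub u)
    have h2 := (hasDerivAt_phase α β x).add h1
    exact h2.congr_deriv (by simp only [q']; ring)
  set S : Set ℝ := {x | ρ ≤ x ^ 2 + (u - x) ^ 2}
  have hS : MeasurableSet S := measurableSet_le (by fun_prop) (by fun_prop)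
  -- The total phase is symmetric under `x ↦ u - x`; on either side of `u / 2` the factor `x + y -
  -- u` has a sign, so the map is injective there.
  set S₁ := S ∩ {x | u < 2 * x}
  set S₂ := S ∩ {x | 2 * x < u}
  have hm₁ : MeasurableSet S₁ := hS.inter (measurableSet_lt (by fun_prop) (by fun_prop))
  have hm₂ : MeasurableSet S₂ := hS.inter (measurableSet_lt (by fun_prop) (by fun_prop))
  have hi₁ : Set.InjOn q S₁ := fun x hx y hy hxy ↦ by
    have := phase_add_phase_sub_inj hρ hu hx.1 hy.1 hxy
    have h1 : u < 2 * x := hx.2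
    have h2 : u < 2 * y := hy.2
    rcases mul_eq_zero.1 this with h3 | h3 <;> linarith
  have hi₂ : Set.InjOn q S₂ := fun x hx y hy hxy ↦ by
    have := phase_add_phase_sub_inj hρ hu hx.1 hy.1 hxy
    have h1 : 2 * x < u := hx.2
    have h2 : 2 * y < u := hy.2
    rcases mul_eq_zero.1 this with h3 | h3 <;> linarith
  have hsub : S ⊆ (S₁ ∪ S₂) ∪ {u / 2} := fun x hx ↦ by
    rcases lt_trichotomy u (2 * x) with h1 | h1 | h1
    · exact Or.inl (Or.inl ⟨hx, h1⟩)
    · exact Or.inr (by simp [h1])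
    · exact Or.inl (Or.inr ⟨hx, h1⟩)
  calc _ ≤ ∫⁻ x in (S₁ ∪ S₂) ∪ {u / 2}, ENNReal.ofReal |q' x| * h (q x) :=
        lintegral_mono_set hsub
    _ ≤ (∫⁻ x in S₁, ENNReal.ofReal |q' x| * h (q x)) +
          (∫⁻ x in S₂, ENNReal.ofReal |q' x| * h (q x)) +
          ∫⁻ x in {u / 2}, ENNReal.ofReal |q' x| * h (q x) :=
        (lintegral_union_le _ _ _).trans (by gcongr; exact lintegral_union_le _ _ _)
    _ ≤ (∫⁻ v, h v) + (∫⁻ v, h v) + 0 := by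
        refine add_le_add (add_le_add ?_ ?_) (by simp)
        · exact setLIntegral_deriv_mul_comp_le hm₁ (fun x _ ↦ hq x) hi₁ h
        · exact setLIntegral_deriv_mul_comp_le hm₂ (fun x _ ↦ hq x) hi₂ h
    _ = _ := by ring

/-- The weight is the Jacobian of `(x, y) ↦ (x + y, p(x) + p(y))`, and this map is at most
two-to-one off a null set. -/
theorem lintegral_phase_pair_le {α β ρ : ℝ} (hρ : 3 * |α| < 5 * |β| * ρ) {g : ℝ × ℝ → ℝ≥0∞}
    (hg : Measurable g) :
    ∫⁻ x, ∫⁻ y, Set.indicator {p : ℝ × ℝ | ρ ≤ p.1 ^ 2 + p.2 ^ 2} 1 (x, y) *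
      ENNReal.ofReal |dphase α β x - dphase α β y| * g (x + y, phase α β x + phase α β y) ≤
      2 * ∫⁻ z, g z := by
  have hS : MeasurableSet {p : ℝ × ℝ | ρ ≤ p.1 ^ 2 + p.2 ^ 2} :=
    measurableSet_le (by fun_prop) (by fun_prop)
  have hI : Measurable (Set.indicator {p : ℝ × ℝ | ρ ≤ p.1 ^ 2 + p.2 ^ 2} (1 : ℝ × ℝ → ℝ≥0∞)) :=
    measurable_one.indicator hS
  have h1 : ∀ x, ∫⁻ y, Set.indicator {p : ℝ × ℝ | ρ ≤ p.1 ^ 2 + p.2 ^ 2} 1 (x, y) *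
      ENNReal.ofReal |dphase α β x - dphase α β y| * g (x + y, phase α β x + phase α β y) =
      ∫⁻ u, Set.indicator {p : ℝ × ℝ | ρ ≤ p.1 ^ 2 + p.2 ^ 2} 1 (x, u - x) *
      ENNReal.ofReal |dphase α β x - dphase α β (u - x)| *
        g (u, phase α β x + phase α β (u - x)) := fun x ↦ by
    rw [← lintegral_sub_right_eq_self _ x]
    simp
  simp_rw [h1]
  rw [lintegral_lintegral_swap (by fun_prop), Measure.volume_eq_prod,
    lintegral_prod _ hg.aemeasurable, ← lintegral_const_mul _ (by fun_prop)]
  refine lintegral_mono_ae ?_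
  -- The fiber `u = 0` is degenerate: `p` is odd, so the total phase vanishes identically on it.
  have : ∀ᵐ u : ℝ, u ≠ 0 := by simp [ae_iff]
  filter_upwards [this] with u hu
  refine le_trans (le_of_eq ?_) (lintegral_phase_pair_fiber_le hρ hu fun v ↦ g (u, v))
  rw [← lintegral_indicator (measurableSet_le (by fun_prop) (by fun_prop))]
  refine lintegral_congr fun x ↦ ?_
  by_cases hx : ρ ≤ x ^ 2 + (u - x) ^ 2 <;> simp [hx]

/-- The difference factors as `(x² - z²) (3 α - 5 β (x² + z²))`. The first factor is at least `3 x²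
/ 4`; in the second the term `3 α` is absorbed by `|β| R² ≤ |β| x²`, leaving `4 |β| x²`. -/
theorem pow_four_le_dphase_sub {α β R x z : ℝ} (hR : 3 * |α| ≤ |β| * R ^ 2) (hR0 : 0 ≤ R)
    (hx : R ≤ |x|) (hz : |z| ≤ |x| / 2) :
    3 * |β| * x ^ 4 ≤ |dphase α β x - dphase α β z| := by
  have hx2 : R ^ 2 ≤ x ^ 2 := by rw [← sq_abs x]; gcongr
  have hz2 : z ^ 2 ≤ x ^ 2 / 4 := by
    rw [← sq_abs x, ← sq_abs z]; nlinarith [abs_nonneg z, abs_nonneg x]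
  have h1 : dphase α β x - dphase α β z = (x ^ 2 - z ^ 2) * (3 * α - 5 * β * (x ^ 2 + z ^ 2)) := by
    unfold dphase; ring
  have h2 : 4 * |β| * x ^ 2 ≤ |3 * α - 5 * β * (x ^ 2 + z ^ 2)| := by
    have h3 := abs_sub_abs_le_abs_sub (5 * β * (x ^ 2 + z ^ 2)) (3 * α)
    rw [abs_sub_comm, abs_mul, abs_mul, abs_mul, abs_of_nonneg (by positivity : 0 ≤ x ^ 2 + z ^ 2)]
      at h3
    norm_num at h3
    nlinarith [abs_nonneg β, mul_nonneg (abs_nonneg β) (sq_nonneg z),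
      mul_le_mul_of_nonneg_left hx2 (abs_nonneg β)]
  rw [h1, abs_mul, abs_of_nonneg (by nlinarith [sq_nonneg x] : 0 ≤ x ^ 2 - z ^ 2)]
  calc 3 * |β| * x ^ 4 = (3 / 4 * x ^ 2) * (4 * |β| * x ^ 2) := by ring
    _ ≤ _ := mul_le_mul (by linarith) h2 (by positivity) (by nlinarith [sq_nonneg x])

/-- The symbol of the interactions in which the frequency of largest modulus is at least twice
another one in modulus. -/
def sepSymbol (R : ℝ) : ℝ × ℝ × ℝ → ℝ≥0∞ :=
  Set.indicator {p | R ≤ |p.1| ∧ |p.2.1| ≤ |p.1| ∧ |p.2.2| ≤ |p.1| / 2}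
    fun p ↦ ENNReal.ofReal (|p.1| ^ (3 / 2 : ℝ))

theorem measurableSet_sep (R : ℝ) : MeasurableSet
    {p : ℝ × ℝ × ℝ | R ≤ |p.1| ∧ |p.2.1| ≤ |p.1| ∧ |p.2.2| ≤ |p.1| / 2} := by
  change MeasurableSet ({p : ℝ × ℝ × ℝ | R ≤ |p.1|} ∩ ({p : ℝ × ℝ × ℝ | |p.2.1| ≤ |p.1|} ∩
    {p : ℝ × ℝ × ℝ | |p.2.2| ≤ |p.1| / 2}))
  exact (measurableSet_le (by fun_prop) (by fun_prop)).inter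
    ((measurableSet_le (by fun_prop) (by fun_prop)).inter
      (measurableSet_le (by fun_prop) (by fun_prop)))

@[fun_prop]
theorem measurable_sepSymbol (R : ℝ) : Measurable (sepSymbol R) :=
  (by fun_prop : Measurable fun p : ℝ × ℝ × ℝ ↦ ENNReal.ofReal (|p.1| ^ (3 / 2 : ℝ))).indicator
    (measurableSet_sep R)

theorem lintegral_indicator_abs_le_mul_inv_le (x : ℝ) (hx : 0 < |x|) :
    ∫⁻ y : ℝ, Set.indicator {y : ℝ | |y| ≤ |x|} 1 y * ENNReal.ofReal (|x|⁻¹) ≤ 2 := by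
  have hs : MeasurableSet {y : ℝ | |y| ≤ |x|} := measurableSet_le (by fun_prop) (by fun_prop)
  rw [lintegral_mul_const _ (measurable_one.indicator hs), lintegral_indicator_one hs]
  have : {y : ℝ | |y| ≤ |x|} = Set.Icc (-|x|) |x| := by ext y; simp [abs_le]
  rw [this, Real.volume_Icc, ← ENNReal.ofReal_mul (by linarith)]
  have : (|x| - -|x|) * |x|⁻¹ = 2 := by field_simp; ring
  rw [this]; simp

/-- Cauchy–Schwarz with the splitting `3/2 = -1/2 + 2`. In the square of `|x| ^ (-1/2) f₁ f₃` the
weight `1 / |x|` compensates for the length of `|y| ≤ |x|`. In the square of `x² f₂ G` the weight `x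
^ 4` is dominated by the Jacobian in `(x, z)` at fixed `y`. -/
theorem freeBound_sep {α β R : ℝ} (hβ : β ≠ 0) (hR1 : 1 ≤ R) (hR : 3 * |α| ≤ |β| * R ^ 2) :
    FreeBound α β (sepSymbol R) := by
  have hβ' : 0 < |β| := abs_pos.2 hβ
  set S := {p : ℝ × ℝ × ℝ | R ≤ |p.1| ∧ |p.2.1| ≤ |p.1| ∧ |p.2.2| ≤ |p.1| / 2} with hSdef
  have hS : MeasurableSet S := measurableSet_sep R
  set c : ℝ≥0 := Real.toNNReal (3 * |β|)⁻¹ with hc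
  refine ⟨4 * c, fun G f₁ f₂ f₃ hG h₁ h₂ h₃ ↦ ?_⟩
  set Ψ : ℝ × ℝ × ℝ → ℝ × ℝ := fun p ↦
    (p.1 + p.2.1 + p.2.2, phase α β p.1 + phase α β p.2.1 + phase α β p.2.2) with hΨ
  have hΨm : Measurable Ψ := by fun_prop
  set A : ℝ × ℝ × ℝ → ℝ≥0∞ := S.indicator fun p ↦
    ENNReal.ofReal (|p.1| ^ (-(1 / 2) : ℝ)) * (f₁ p.1 * f₃ p.2.2) with hA
  set B : ℝ × ℝ × ℝ → ℝ≥0∞ := S.indicator fun p ↦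
    ENNReal.ofReal (p.1 ^ 2) * (f₂ p.2.1 * G (Ψ p)) with hB
  have hAm : Measurable A := Measurable.indicator (by fun_prop) hS
  have hBm : Measurable B := Measurable.indicator (by fun_prop) hS
  have hprod : ∫⁻ x, ∫⁻ y, ∫⁻ z, sepSymbol R (x, y, z) *
      G (x + y + z, phase α β x + phase α β y + phase α β z) * (f₁ x * f₂ y * f₃ z) =
      ∫⁻ p, A p * B p := by
    rw [lintegral_triple (by fun_prop)]
    refine lintegral_congr fun x ↦ lintegral_congr fun y ↦ lintegral_congr fun z ↦ ?_
    by_cases hp : (x, y, z) ∈ S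
    · have hx : 0 < |x| := lt_of_lt_of_le (by linarith) hp.1
      have : |x| ^ (3 / 2 : ℝ) = |x| ^ (-(1 / 2) : ℝ) * x ^ 2 := by
        rw [← sq_abs x, ← Real.rpow_natCast, ← Real.rpow_add hx]; norm_num
      simp only [sepSymbol, ← hSdef, hA, hB, Set.indicator_of_mem hp]
      rw [this, ENNReal.ofReal_mul (by positivity)]
      simp only [hΨ]; ring
    · simp only [sepSymbol, ← hSdef, hA, hB, Set.indicator_of_notMem hp]; simp
  have hA2 : ∫⁻ p, A p ^ 2 ≤ 2 * ((∫⁻ x, f₁ x ^ 2) * ∫⁻ x, f₃ x ^ 2) := by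
    have hle : ∀ x z, ∫⁻ y, A (x, y, z) ^ 2 ≤ 2 * (f₁ x ^ 2 * f₃ z ^ 2) := fun x z ↦ by
      by_cases hx : R ≤ |x|
      · have hx0 : 0 < |x| := by linarith
        have hpt : ∀ y, A (x, y, z) ^ 2 ≤ Set.indicator {y : ℝ | |y| ≤ |x|} 1 y *
            ENNReal.ofReal (|x|⁻¹) * (f₁ x ^ 2 * f₃ z ^ 2) := fun y ↦ by
          by_cases hp : (x, y, z) ∈ S
          · have hy : |y| ≤ |x| := hp.2.1
            simp only [hA, Set.indicator_of_mem hp, mul_pow]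
            rw [Set.indicator_of_mem (by simpa using hy),
              ← ENNReal.ofReal_pow (by positivity), ← Real.rpow_natCast, ← Real.rpow_mul hx0.le]
            norm_num [Real.rpow_neg_one]
          · simp [hA, Set.indicator_of_notMem hp]
        have hs : MeasurableSet {y : ℝ | |y| ≤ |x|} := measurableSet_le (by fun_prop) (by fun_prop)
        calc _ ≤ _ := lintegral_mono hpt
          _ = (∫⁻ y : ℝ, Set.indicator {y : ℝ | |y| ≤ |x|} 1 y * ENNReal.ofReal (|x|⁻¹)) *
              (f₁ x ^ 2 * f₃ z ^ 2) :=
            lintegral_mul_const _ ((measurable_one.indicator hs).mul measurable_const)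
          _ ≤ _ := by gcongr; exact lintegral_indicator_abs_le_mul_inv_le x hx0
      · have : ∀ y, A (x, y, z) = 0 := fun y ↦
          Set.indicator_of_notMem (fun hp ↦ hx hp.1) _
        simp [this]
    rw [lintegral_triple (by fun_prop)]
    calc ∫⁻ x, ∫⁻ y, ∫⁻ z, A (x, y, z) ^ 2 = ∫⁻ x, ∫⁻ z, ∫⁻ y, A (x, y, z) ^ 2 :=
          lintegral_congr fun x ↦ lintegral_lintegral_swap (by fun_prop)
      _ ≤ ∫⁻ x, ∫⁻ z, 2 * (f₁ x ^ 2 * f₃ z ^ 2) :=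
          lintegral_mono fun x ↦ lintegral_mono fun z ↦ hle x z
      _ = _ := by
        rw [← lintegral_mul_const _ (by fun_prop), ← lintegral_const_mul _ (by fun_prop)]
        refine lintegral_congr fun x ↦ ?_
        rw [← lintegral_const_mul _ (by fun_prop), ← lintegral_const_mul _ (by fun_prop)]
  have hB2 : ∫⁻ p, B p ^ 2 ≤ 2 * c * ((∫⁻ x, f₂ x ^ 2) * ∫⁻ z, G z ^ 2) := by
    have hI : Measurable (Set.indicator {p : ℝ × ℝ | R ^ 2 ≤ p.1 ^ 2 + p.2 ^ 2}
        (1 : ℝ × ℝ → ℝ≥0∞)) :=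
      measurable_one.indicator (measurableSet_le (by fun_prop) (by fun_prop))
    have hpt : ∀ x y z, B (x, y, z) ^ 2 ≤ c * f₂ y ^ 2 *
        (Set.indicator {p : ℝ × ℝ | R ^ 2 ≤ p.1 ^ 2 + p.2 ^ 2} 1 (x, z) *
          ENNReal.ofReal |dphase α β x - dphase α β z| *
          G (x + z + y, phase α β x + phase α β z + phase α β y) ^ 2) := fun x y z ↦ by
      by_cases hp : (x, y, z) ∈ S
      · have hx : R ≤ |x| := hp.1
        have hx2 : R ^ 2 ≤ x ^ 2 + z ^ 2 := by
          rw [← sq_abs x]; nlinarith [sq_nonneg z]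
        have hd := pow_four_le_dphase_sub hR (by linarith) hx hp.2.2
        have hd' : ENNReal.ofReal (x ^ 2) ^ 2 ≤
            c * ENNReal.ofReal |dphase α β x - dphase α β z| := by
          rw [hc, ← ENNReal.ofReal_pow (by positivity), ENNReal.ofNNReal_toNNReal,
            ← ENNReal.ofReal_mul (by positivity)]
          refine ENNReal.ofReal_le_ofReal ?_
          rw [inv_mul_eq_div, le_div_iff₀ (by positivity)]
          calc _ = 3 * |β| * x ^ 4 := by ring
            _ ≤ _ := hd
        simp only [hB, Set.indicator_of_mem hp, mul_pow, hΨ]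
        rw [Set.indicator_of_mem (by simpa using hx2), Pi.one_apply, one_mul,
          add_right_comm x z y, add_right_comm (phase α β x) (phase α β z)]
        calc _ ≤ c * ENNReal.ofReal |dphase α β x - dphase α β z| * (f₂ y ^ 2 *
            G (x + y + z, phase α β x + phase α β y + phase α β z) ^ 2) := by gcongr
          _ = _ := by ring
      · simp [hB, Set.indicator_of_notMem hp]
    have hρ : 3 * |α| < 5 * |β| * R ^ 2 := by
      have : 0 < |β| * R ^ 2 := by positivity
      linarith
    have hin : ∀ y, ∫⁻ x, ∫⁻ z,
        Set.indicator {p : ℝ × ℝ | R ^ 2 ≤ p.1 ^ 2 + p.2 ^ 2} 1 (x, z) *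
          ENNReal.ofReal |dphase α β x - dphase α β z| *
          G (x + z + y, phase α β x + phase α β z + phase α β y) ^ 2 ≤
        2 * ∫⁻ z, G z ^ 2 := fun y ↦ by
      refine (lintegral_phase_pair_le hρ
        (g := fun w ↦ G (w + (y, phase α β y)) ^ 2) (by fun_prop)).trans (le_of_eq ?_)
      rw [lintegral_add_right_eq_self (fun w ↦ G w ^ 2)]
    -- The middle frequency `y` is moved outside, so that the change of variables in `(x, z)` acts
    -- on a translate of `G`.
    rw [lintegral_triple (by fun_prop), lintegral_lintegral_swap (by fun_prop)]
    calc _ ≤ ∫⁻ y, ∫⁻ x, ∫⁻ z, c * f₂ y ^ 2 *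
        (Set.indicator {p : ℝ × ℝ | R ^ 2 ≤ p.1 ^ 2 + p.2 ^ 2} 1 (x, z) *
          ENNReal.ofReal |dphase α β x - dphase α β z| *
          G (x + z + y, phase α β x + phase α β z + phase α β y) ^ 2) :=
          lintegral_mono fun y ↦ lintegral_mono fun x ↦ lintegral_mono fun z ↦ hpt x y z
      _ = ∫⁻ y, c * f₂ y ^ 2 * ∫⁻ x, ∫⁻ z,
        (Set.indicator {p : ℝ × ℝ | R ^ 2 ≤ p.1 ^ 2 + p.2 ^ 2} 1 (x, z) *
          ENNReal.ofReal |dphase α β x - dphase α β z| *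
          G (x + z + y, phase α β x + phase α β z + phase α β y) ^ 2) := by
          refine lintegral_congr fun y ↦ ?_
          rw [← lintegral_const_mul _ (by fun_prop)]
          refine lintegral_congr fun x ↦ ?_
          rw [← lintegral_const_mul _ (by fun_prop)]
      _ ≤ ∫⁻ y, c * f₂ y ^ 2 * (2 * ∫⁻ z, G z ^ 2) := by
          gcongr with y; exact hin y
      _ = _ := by
          rw [lintegral_mul_const _ (by fun_prop), lintegral_const_mul _ (by fun_prop)]
          ring
  rw [hprod]
  calc _ ≤ _ := sq_lintegral_mul_le volume hAm.aemeasurable hBm.aemeasurable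
    _ ≤ _ := mul_le_mul' hA2 hB2
    _ = _ := by push_cast; ring

end

/-! ### Comparable positive frequencies: density of the total frequency and phase -/

section

open MeasureTheory

theorem mul_mul_le_cube_of_add_eq {x y z m : ℝ} (hx : 0 ≤ x) (hy : 0 ≤ y) (hz : 0 ≤ z)
    (h : x + y + z = 3 * m) : x * y * z ≤ m ^ 3 := by
  have hm : m = (x + y + z) / 3 := by linarith
  rw [hm]
  nlinarith [mul_nonneg hx (sq_nonneg (y - z)), mul_nonneg hx (sq_nonneg (x - y)),
    mul_nonneg hx (sq_nonneg (x - z)), mul_nonneg hy (sq_nonneg (y - z)),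
    mul_nonneg hy (sq_nonneg (x - y)), mul_nonneg hy (sq_nonneg (x - z)),
    mul_nonneg hz (sq_nonneg (y - z)), mul_nonneg hz (sq_nonneg (x - y)),
    mul_nonneg hz (sq_nonneg (x - z))]

/-- Quantitative convexity of the phase beyond `R`: the right side is `(x - m)² (x + m) (-5 β (x² +
m²) + 3 α)`, and the condition on `R` bounds the last factor below by `-β m²`. -/
theorem cube_mul_sq_le_dphase_sub {α β R x m : ℝ} (hβ : β < 0) (hR0 : 0 < R)
    (hR : 3 * |α| ≤ |β| * R ^ 2) (hx : R ≤ x) (hm : R ≤ m) :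
    -β * m ^ 3 * (x - m) ^ 2 ≤ (x - m) * (dphase α β x - dphase α β m) := by
  have h1 : (x - m) * (dphase α β x - dphase α β m) =
      (x - m) ^ 2 * ((x + m) * (-5 * β * (x ^ 2 + m ^ 2) + 3 * α)) := by
    unfold dphase; ring
  have hx2 : R ^ 2 ≤ x ^ 2 := by gcongr
  have h2 : -β * m ^ 2 ≤ -5 * β * (x ^ 2 + m ^ 2) + 3 * α := by
    rw [abs_of_neg hβ] at hR
    have h3 := neg_abs_le α
    have h4 := mul_le_mul_of_nonneg_left hx2 (by linarith : 0 ≤ -β)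
    have h5 : 0 ≤ -β * m ^ 2 := by nlinarith [sq_nonneg m]
    have h6 : 0 ≤ -β * R ^ 2 := by nlinarith [sq_nonneg R]
    nlinarith
  have h5 : 0 ≤ -β * m ^ 2 := by nlinarith [sq_nonneg m]
  rw [h1]
  calc -β * m ^ 3 * (x - m) ^ 2 = (x - m) ^ 2 * (m * (-β * m ^ 2)) := by ring
    _ ≤ _ := mul_le_mul_of_nonneg_left
      (mul_le_mul (by linarith) h2 h5 (by linarith)) (sq_nonneg _)

/-- Radial estimate for the total phase of three positive frequencies of given sum, about the
configuration where they are equal. -/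
theorem lintegral_phase_ray_le {α β R m c d : ℝ} (hβ : β < 0) (hR0 : 0 < R)
    (hR : 3 * |α| ≤ |β| * R ^ 2) (hcd : c ^ 2 + d ^ 2 = 1) (h : ℝ → ℝ≥0∞) :
    ∫⁻ r in {r | 0 < r ∧ R ≤ m + r * c ∧ R ≤ m + r * d ∧ R ≤ m - r * c - r * d},
      ENNReal.ofReal (-β * (r * ((m + r * c) * (m + r * d) * (m - r * c - r * d)))) *
        h (phase α β (m + r * c) + phase α β (m + r * d) + phase α β (m - r * c - r * d)) ≤
      ∫⁻ v, h v := by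
  set S := {r | 0 < r ∧ R ≤ m + r * c ∧ R ≤ m + r * d ∧ R ≤ m - r * c - r * d} with hSdef
  set Φ : ℝ → ℝ := fun r ↦
    phase α β (m + r * c) + phase α β (m + r * d) + phase α β (m - r * c - r * d)
  set Φ' : ℝ → ℝ := fun r ↦ dphase α β (m + r * c) * c + dphase α β (m + r * d) * d +
    dphase α β (m - r * c - r * d) * (-c - d)
  have hΦ : ∀ r, HasDerivAt Φ (Φ' r) r := fun r ↦ by
    have l : ∀ e : ℝ, HasDerivAt (fun r ↦ m + r * e) e r := fun e ↦ by
      simpa using ((hasDerivAt_id r).mul_const e).const_add m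
    have h1 := (hasDerivAt_phase α β (m + r * c)).comp r (l c)
    have h2 := (hasDerivAt_phase α β (m + r * d)).comp r (l d)
    have l3 : HasDerivAt (fun r ↦ m - r * c - r * d) (-c - d) r := by
      have := l (-c - d)
      refine this.congr_of_eventuallyEq (Filter.Eventually.of_forall fun r ↦ ?_)
      ring
    have h3 := (hasDerivAt_phase α β (m - r * c - r * d)).comp r l3
    exact (h1.add h2).add h3
  have hlow : ∀ r ∈ S, -β * (r * ((m + r * c) * (m + r * d) * (m - r * c - r * d))) ≤ Φ' r := by
    rintro r ⟨hr, hx, hy, hz⟩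
    have hm : R ≤ m := by linarith
    have k1 := cube_mul_sq_le_dphase_sub hβ hR0 hR hx hm
    have k2 := cube_mul_sq_le_dphase_sub hβ hR0 hR hy hm
    have k3 := cube_mul_sq_le_dphase_sub hβ hR0 hR hz hm
    have hm3 : 0 ≤ -β * m ^ 3 := mul_nonneg (by linarith) (pow_nonneg (by linarith) 3)
    have h1 : -β * m ^ 3 * r ^ 2 ≤ r * Φ' r := by
      -- The directions `c`, `d`, `-c - d` sum to zero, so `dphase α β m` may be subtracted from
      -- each term.
      have e1 : r * Φ' r = (m + r * c - m) * (dphase α β (m + r * c) - dphase α β m) +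
          (m + r * d - m) * (dphase α β (m + r * d) - dphase α β m) +
          (m - r * c - r * d - m) * (dphase α β (m - r * c - r * d) - dphase α β m) := by
        simp only [Φ']; ring
      have e2 : -β * m ^ 3 * r ^ 2 = -β * m ^ 3 * (m + r * c - m) ^ 2 +
          -β * m ^ 3 * (m + r * d - m) ^ 2 := by
        linear_combination (-(-β * m ^ 3 * r ^ 2)) * hcd
      have e3 : 0 ≤ -β * m ^ 3 * (m - r * c - r * d - m) ^ 2 := mul_nonneg hm3 (sq_nonneg _)
      linarith
    have h2 : -β * m ^ 3 * r ≤ Φ' r := by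
      refine le_of_mul_le_mul_left ?_ hr
      linarith [h1]
    -- The frequencies sum to `3 m`, so by the arithmetic-geometric mean inequality their product is
    -- at most `m ^ 3`.
    have h3 := mul_mul_le_cube_of_add_eq (m := m) (hR0.le.trans hx) (hR0.le.trans hy)
      (hR0.le.trans hz) (by ring)
    calc _ = -β * r * ((m + r * c) * (m + r * d) * (m - r * c - r * d)) := by ring
      _ ≤ -β * r * m ^ 3 := mul_le_mul_of_nonneg_left h3 (mul_nonneg (by linarith) hr.le)
      _ ≤ _ := by linarith [h2]
  have hpos : ∀ r ∈ S, 0 < Φ' r := fun r hr ↦ by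
    refine lt_of_lt_of_le ?_ (hlow r hr)
    obtain ⟨hr, hx, hy, hz⟩ := hr
    have := hR0.trans_le hx
    have := hR0.trans_le hy
    have := hR0.trans_le hz
    have : 0 < -β := by linarith
    positivity
  -- Convexity makes `S` an interval, so that a positive derivative gives injectivity.
  have hconv : Convex ℝ S := by
    rw [convex_iff_forall_pos]
    rintro r ⟨hr, hx, hy, hz⟩ r' ⟨hr', hx', hy', hz'⟩ a b ha hb hab
    have hb' : b = 1 - a := by linarith
    simp only [smul_eq_mul]
    refine ⟨by positivity, ?_, ?_, ?_⟩
    · have := mul_le_mul_of_nonneg_left hx ha.le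
      have := mul_le_mul_of_nonneg_left hx' hb.le
      subst hb'; nlinarith
    · have := mul_le_mul_of_nonneg_left hy ha.le
      have := mul_le_mul_of_nonneg_left hy' hb.le
      subst hb'; nlinarith
    · have := mul_le_mul_of_nonneg_left hz ha.le
      have := mul_le_mul_of_nonneg_left hz' hb.le
      subst hb'; nlinarith
  have hmono : StrictMonoOn Φ S := by
    refine strictMonoOn_of_deriv_pos hconv
      (fun r _ ↦ (hΦ r).continuousAt.continuousWithinAt) fun r hr ↦ ?_
    rw [(hΦ r).deriv]
    exact hpos r (interior_subset hr)
  have hS : MeasurableSet S := hconv.ordConnected.measurableSet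
  calc _ ≤ ∫⁻ r in S, ENNReal.ofReal |Φ' r| * h (Φ r) := by
        refine setLIntegral_mono' hS fun r hr ↦ ?_
        gcongr
        exact (hlow r hr).trans (le_abs_self _)
    _ ≤ _ := setLIntegral_deriv_mul_comp_le hS (fun r _ ↦ hΦ r) hmono.injOn h

theorem measurableSet_triple_ge (R : ℝ) :
    MeasurableSet {p : ℝ × ℝ × ℝ | R ≤ p.1 ∧ R ≤ p.2.1 ∧ R ≤ p.2.2} := by
  change MeasurableSet ({p : ℝ × ℝ × ℝ | R ≤ p.1} ∩ ({p : ℝ × ℝ × ℝ | R ≤ p.2.1} ∩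
    {p : ℝ × ℝ × ℝ | R ≤ p.2.2}))
  exact (measurableSet_le (by fun_prop) (by fun_prop)).inter
    ((measurableSet_le (by fun_prop) (by fun_prop)).inter
      (measurableSet_le (by fun_prop) (by fun_prop)))

/-- In polar coordinates about the diagonal point `(m, m, m)`, the area element supplies the factor
`r` of the ray estimate, and the constant is the total angle. -/
theorem lintegral_phase_triple_fiber_le {α β R : ℝ} (hβ : β < 0) (hR0 : 0 < R)
    (hR : 3 * |α| ≤ |β| * R ^ 2) {h : ℝ → ℝ≥0∞} (hh : Measurable h) (m : ℝ) :
    ∫⁻ q : ℝ × ℝ, Set.indicator {p : ℝ × ℝ × ℝ | R ≤ p.1 ∧ R ≤ p.2.1 ∧ R ≤ p.2.2}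
        (fun p ↦ ENNReal.ofReal (-β * (p.1 * p.2.1 * p.2.2)) *
          h (phase α β p.1 + phase α β p.2.1 + phase α β p.2.2))
        (m + q.1, m + q.2, m - q.1 - q.2) ≤ ENNReal.ofReal (2 * Real.pi) * ∫⁻ v, h v := by
  set H : ℝ × ℝ × ℝ → ℝ≥0∞ :=
    Set.indicator {p : ℝ × ℝ × ℝ | R ≤ p.1 ∧ R ≤ p.2.1 ∧ R ≤ p.2.2}
      (fun p ↦ ENNReal.ofReal (-β * (p.1 * p.2.1 * p.2.2)) *
        h (phase α β p.1 + phase α β p.2.1 + phase α β p.2.2)) with hH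
  have hHm : Measurable H := Measurable.indicator (by fun_prop) (measurableSet_triple_ge R)
  rw [← lintegral_comp_polarCoord_symm, polarCoord_target, Measure.volume_eq_prod,
    ← Measure.prod_restrict]
  simp only [polarCoord_symm_apply, smul_eq_mul]
  rw [lintegral_prod_symm _ (by fun_prop)]
  have hθ : ∀ θ : ℝ, ∫⁻ r in Set.Ioi (0 : ℝ), ENNReal.ofReal r *
      H (m + r * Real.cos θ, m + r * Real.sin θ, m - r * Real.cos θ - r * Real.sin θ) ≤
      ∫⁻ v, h v := fun θ ↦ by
    refine le_trans (le_of_eq ?_) (lintegral_phase_ray_le (m := m) hβ hR0 hR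
      (Real.cos_sq_add_sin_sq θ) h)
    have hS : MeasurableSet {r : ℝ | 0 < r ∧ R ≤ m + r * Real.cos θ ∧ R ≤ m + r * Real.sin θ ∧
        R ≤ m - r * Real.cos θ - r * Real.sin θ} := by
      have h1 : Measurable fun r : ℝ ↦
        (m + r * Real.cos θ, m + r * Real.sin θ, m - r * Real.cos θ - r * Real.sin θ) := by fun_prop
      exact measurableSet_Ioi.inter (h1 (measurableSet_triple_ge R))
    rw [← lintegral_indicator measurableSet_Ioi, ← lintegral_indicator hS]
    refine lintegral_congr fun r ↦ ?_
    by_cases hr : 0 < r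
    · by_cases hr2 : R ≤ m + r * Real.cos θ ∧ R ≤ m + r * Real.sin θ ∧
        R ≤ m - r * Real.cos θ - r * Real.sin θ
      · rw [Set.indicator_of_mem (by exact hr), Set.indicator_of_mem (by exact ⟨hr, hr2⟩), hH,
          Set.indicator_of_mem (by exact hr2), ← mul_assoc, ← ENNReal.ofReal_mul hr.le]
        congr 2
        ring
      · rw [Set.indicator_of_mem (by exact hr),
          Set.indicator_of_notMem (by exact fun hc ↦ hr2 hc.2), hH,
          Set.indicator_of_notMem (by exact hr2), mul_zero]
    · rw [Set.indicator_of_notMem (by exact hr),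
        Set.indicator_of_notMem (by exact fun hc ↦ hr hc.1)]
  calc _ ≤ ∫⁻ θ in Set.Ioo (-Real.pi) Real.pi, ∫⁻ v, h v := lintegral_mono fun θ ↦ hθ θ
    _ = _ := by
      rw [setLIntegral_const, Real.volume_Ioo, mul_comm]
      congr 2
      ring

/-- The push-forward of `ξ₁ ξ₂ ξ₃ dξ` under total frequency and total phase, for positive
frequencies, has bounded density. -/
theorem lintegral_phase_triple_le_of_neg {α β R : ℝ} (hβ : β < 0) (hR0 : 0 < R)
    (hR : 3 * |α| ≤ |β| * R ^ 2) {g : ℝ × ℝ → ℝ≥0∞} (hg : Measurable g) :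
    ∫⁻ x, ∫⁻ y, ∫⁻ z, Set.indicator {p : ℝ × ℝ × ℝ | R ≤ p.1 ∧ R ≤ p.2.1 ∧ R ≤ p.2.2}
        (fun p ↦ ENNReal.ofReal (|β| * (p.1 * p.2.1 * p.2.2)) *
          g (p.1 + p.2.1 + p.2.2, phase α β p.1 + phase α β p.2.1 + phase α β p.2.2)) (x, y, z) ≤
      ENNReal.ofReal (2 * Real.pi) * ∫⁻ v, g v := by
  rw [abs_of_neg hβ] at hR ⊢
  set H : ℝ × ℝ × ℝ → ℝ≥0∞ :=
    Set.indicator {p : ℝ × ℝ × ℝ | R ≤ p.1 ∧ R ≤ p.2.1 ∧ R ≤ p.2.2}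
        (fun p ↦ ENNReal.ofReal (-β * (p.1 * p.2.1 * p.2.2)) *
          g (p.1 + p.2.1 + p.2.2, phase α β p.1 + phase α β p.2.1 + phase α β p.2.2)) with hH
  have hHm : Measurable H := Measurable.indicator (by fun_prop) (measurableSet_triple_ge R)
  -- The third frequency is replaced by the sum `s`, and the other two are centered at `s / 3`.
  have e1 : ∫⁻ x, ∫⁻ y, ∫⁻ z, H (x, y, z) =
      ∫⁻ s : ℝ, ∫⁻ q : ℝ × ℝ, H (s / 3 + q.1, s / 3 + q.2, s / 3 - q.1 - q.2) := by
    calc _ = ∫⁻ x, ∫⁻ y, ∫⁻ s, H (x, y, s - (x + y)) := by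
          refine lintegral_congr fun x ↦ lintegral_congr fun y ↦ ?_
          rw [lintegral_sub_right_eq_self (fun z ↦ H (x, y, z))]
      _ = ∫⁻ x, ∫⁻ s, ∫⁻ y, H (x, y, s - (x + y)) :=
          lintegral_congr fun x ↦ lintegral_lintegral_swap (by fun_prop)
      _ = ∫⁻ s, ∫⁻ x, ∫⁻ y, H (x, y, s - (x + y)) := lintegral_lintegral_swap (by fun_prop)
      _ = _ := by
          refine lintegral_congr fun s ↦ ?_
          rw [Measure.volume_eq_prod, lintegral_prod _ (by fun_prop),
            ← lintegral_add_left_eq_self _ (s / 3)]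
          refine lintegral_congr fun x ↦ ?_
          rw [← lintegral_add_left_eq_self _ (s / 3)]
          refine lintegral_congr fun y ↦ ?_
          congr 3
          ring
  rw [e1, Measure.volume_eq_prod, lintegral_prod _ hg.aemeasurable,
    ← lintegral_const_mul _ (by fun_prop)]
  refine lintegral_mono fun s ↦ ?_
  refine le_trans (le_of_eq ?_) (lintegral_phase_triple_fiber_le (α := α) hβ hR0
    (by rw [abs_of_neg hβ]; exact hR) (h := fun v ↦ g (s, v)) (by fun_prop) (s / 3))
  refine lintegral_congr fun q ↦ ?_
  simp only [hH, Set.indicator]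
  split_ifs
  · congr 3; ring
  · rfl

theorem phase_neg_neg (α β ξ : ℝ) : phase (-α) (-β) ξ = -phase α β ξ := by
  unfold phase; ring

/-- The case `β > 0` follows by the reflection `τ ↦ -τ`, which changes the signs of both `α` and
`β`. -/
theorem lintegral_phase_triple_le {α β R : ℝ} (hβ : β ≠ 0) (hR0 : 0 < R)
    (hR : 3 * |α| ≤ |β| * R ^ 2) {g : ℝ × ℝ → ℝ≥0∞} (hg : Measurable g) :
    ∫⁻ x, ∫⁻ y, ∫⁻ z, Set.indicator {p : ℝ × ℝ × ℝ | R ≤ p.1 ∧ R ≤ p.2.1 ∧ R ≤ p.2.2}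
        (fun p ↦ ENNReal.ofReal (|β| * (p.1 * p.2.1 * p.2.2)) *
          g (p.1 + p.2.1 + p.2.2, phase α β p.1 + phase α β p.2.1 + phase α β p.2.2)) (x, y, z) ≤
      ENNReal.ofReal (2 * Real.pi) * ∫⁻ v, g v := by
  rcases lt_or_gt_of_ne hβ with h | h
  · exact lintegral_phase_triple_le_of_neg h hR0 hR hg
  · have key := lintegral_phase_triple_le_of_neg (α := -α) (β := -β) (R := R) (by linarith) hR0
      (by simpa using hR) (g := fun v ↦ g (v.1, -v.2)) (by fun_prop)
    have e : ∫⁻ v : ℝ × ℝ, g (v.1, -v.2) = ∫⁻ v, g v := by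
      rw [Measure.volume_eq_prod, lintegral_prod _ (by fun_prop), lintegral_prod _ (by fun_prop)]
      refine lintegral_congr fun x ↦ ?_
      exact lintegral_neg_eq_self (fun y ↦ g (x, y))
    rw [e] at key
    refine le_trans (le_of_eq ?_) key
    simp only [phase_neg_neg, abs_neg, neg_add, neg_neg]

/-- The symbol `|ξ| ^ (1/2)` restricted to `ξ ≥ R`. -/
def posHalf (R ξ : ℝ) : ℝ≥0∞ := (Set.Ici R).indicator (fun ξ ↦ ENNReal.ofReal (|ξ| ^ (1 / 2 : ℝ))) ξ

/-- The symbol `|ξ| ^ (1/2)` restricted to `|ξ| ≥ R`. -/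
def absHalf (R ξ : ℝ) : ℝ≥0∞ :=
  {ξ : ℝ | R ≤ |ξ|}.indicator (fun ξ ↦ ENNReal.ofReal (|ξ| ^ (1 / 2 : ℝ))) ξ

@[fun_prop]
theorem measurable_posHalf (R : ℝ) : Measurable (posHalf R) :=
  Measurable.indicator (by fun_prop) measurableSet_Ici

@[fun_prop]
theorem measurable_absHalf (R : ℝ) : Measurable (absHalf R) :=
  Measurable.indicator (by fun_prop) (measurableSet_le (by fun_prop) (by fun_prop))

theorem absHalf_eq {R : ℝ} (hR : 0 < R) (ξ : ℝ) : absHalf R ξ = posHalf R ξ + posHalf R (-ξ) := by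
  unfold absHalf posHalf
  rcases le_total 0 ξ with h | h
  · have h2 : ¬ R ≤ -ξ := by linarith
    by_cases h1 : R ≤ ξ <;> simp [h1, h2, Set.indicator, abs_of_nonneg h]
  · have h2 : ¬ R ≤ ξ := by linarith
    by_cases h1 : R ≤ -ξ <;> simp [h1, h2, Set.indicator, abs_of_nonpos h]

/-- Cauchy–Schwarz with the whole symbol on `G`: its square is `ξ₁ ξ₂ ξ₃`, exactly the weight whose
push-forward has bounded density. -/
theorem freeBound_pos {α β R : ℝ} (hβ : β ≠ 0) (hR0 : 0 < R) (hR : 3 * |α| ≤ |β| * R ^ 2) :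
    FreeBound α β fun p ↦ posHalf R p.1 * posHalf R p.2.1 * posHalf R p.2.2 := by
  have hβ' : 0 < |β| := abs_pos.2 hβ
  refine ⟨(Real.toNNReal |β|⁻¹) * (Real.toNNReal (2 * Real.pi)), fun G f₁ f₂ f₃ hG h₁ h₂ h₃ ↦ ?_⟩
  set A : ℝ × ℝ × ℝ → ℝ≥0∞ := fun p ↦ f₁ p.1 * f₂ p.2.1 * f₃ p.2.2
  set B : ℝ × ℝ × ℝ → ℝ≥0∞ := fun p ↦ posHalf R p.1 * posHalf R p.2.1 * posHalf R p.2.2 *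
    G (p.1 + p.2.1 + p.2.2, phase α β p.1 + phase α β p.2.1 + phase α β p.2.2)
  have hA : Measurable A := by fun_prop
  have hB : Measurable B := by fun_prop
  have hprod : ∫⁻ x, ∫⁻ y, ∫⁻ z, posHalf R x * posHalf R y * posHalf R z *
      G (x + y + z, phase α β x + phase α β y + phase α β z) * (f₁ x * f₂ y * f₃ z) =
      ∫⁻ p, A p * B p := by
    rw [lintegral_triple (by fun_prop)]
    refine lintegral_congr fun x ↦ lintegral_congr fun y ↦ lintegral_congr fun z ↦ ?_
    simp only [A, B]
    ring
  have hA2 : ∫⁻ p, A p ^ 2 = (∫⁻ x, f₁ x ^ 2) * (∫⁻ x, f₂ x ^ 2) * ∫⁻ x, f₃ x ^ 2 := by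
    have := const_mul_lintegral_mul_lintegral_mul_lintegral (μ := (volume : Measure ℝ)) 1
      (h₁.pow_const 2) (h₂.pow_const 2) (h₃.pow_const 2)
    rw [one_mul] at this
    rw [lintegral_triple (by fun_prop), this]
    refine lintegral_congr fun x ↦ lintegral_congr fun y ↦ lintegral_congr fun z ↦ ?_
    simp only [A]
    ring
  have hsq : ∀ x, posHalf R x ^ 2 = (Set.Ici R).indicator (fun ξ ↦ ENNReal.ofReal ξ) x := fun x ↦ by
    by_cases hx : R ≤ x
    · have : 0 ≤ x := by linarith
      simp only [posHalf, Set.indicator, Set.mem_Ici, hx, if_true, abs_of_nonneg this]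
      rw [← ENNReal.ofReal_pow (by positivity), ← Real.rpow_natCast, ← Real.rpow_mul this]
      norm_num
    · simp [posHalf, Set.indicator, hx]
  have hB2 : ∫⁻ p, B p ^ 2 ≤
      (ENNReal.ofReal |β|⁻¹ * ENNReal.ofReal (2 * Real.pi)) * ∫⁻ z, G z ^ 2 := by
    have hI : Measurable (Set.indicator {p : ℝ × ℝ × ℝ | R ≤ p.1 ∧ R ≤ p.2.1 ∧ R ≤ p.2.2}
        (fun p ↦ ENNReal.ofReal (|β| * (p.1 * p.2.1 * p.2.2)) *
          G (p.1 + p.2.1 + p.2.2, phase α β p.1 + phase α β p.2.1 + phase α β p.2.2) ^ 2)) :=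
      Measurable.indicator (by fun_prop) (measurableSet_triple_ge R)
    rw [mul_assoc]
    refine le_trans (le_of_eq ?_) (mul_le_mul_right
      (lintegral_phase_triple_le hβ hR0 hR (g := fun v ↦ G v ^ 2) (by fun_prop)) _)
    rw [← lintegral_triple hI, ← lintegral_const_mul _ hI]
    refine lintegral_congr fun p ↦ ?_
    simp only [B, mul_pow, hsq]
    by_cases hp : R ≤ p.1 ∧ R ≤ p.2.1 ∧ R ≤ p.2.2
    · have h1 : 0 ≤ p.1 := by linarith [hp.1]
      have h2 : 0 ≤ p.2.1 := by linarith [hp.2.1]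
      rw [Set.indicator_of_mem (by exact hp.1), Set.indicator_of_mem (by exact hp.2.1),
        Set.indicator_of_mem (by exact hp.2.2), Set.indicator_of_mem (by exact hp), ← mul_assoc,
        ← ENNReal.ofReal_mul (by positivity), ← ENNReal.ofReal_mul (by positivity),
        ← ENNReal.ofReal_mul (by positivity)]
      congr 2
      field_simp
    · rw [Set.indicator_of_notMem (a := p) (by exact hp), mul_zero]
      by_cases h1 : R ≤ p.1
      · by_cases h2 : R ≤ p.2.1
        · have h3 : ¬ R ≤ p.2.2 := fun h3 ↦ hp ⟨h1, h2, h3⟩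
          simp [h3]
        · simp [h2]
      · simp [h1]
  change (∫⁻ x, ∫⁻ y, ∫⁻ z, posHalf R x * posHalf R y * posHalf R z *
      G (x + y + z, phase α β x + phase α β y + phase α β z) * (f₁ x * f₂ y * f₃ z)) ^ 2 ≤ _
  rw [hprod]
  calc _ ≤ _ := sq_lintegral_mul_le volume hA.aemeasurable hB.aemeasurable
    _ ≤ ((∫⁻ x, f₁ x ^ 2) * (∫⁻ x, f₂ x ^ 2) * ∫⁻ x, f₃ x ^ 2) *
        ((ENNReal.ofReal |β|⁻¹ * ENNReal.ofReal (2 * Real.pi)) * ∫⁻ z, G z ^ 2) := by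
      rw [hA2]; exact mul_le_mul' le_rfl hB2
    _ = _ := by rw [ENNReal.coe_mul, ENNReal.ofNNReal_toNNReal, ENNReal.ofNNReal_toNNReal]; ring

end

/-! ### Reflection to arbitrary signs, and the size of the symbol -/

section

open MeasureTheory

variable {α β b : ℝ}

/-- The phase is odd; hence reflecting a factor preserves its modulation weight. -/
theorem modWeight_neg (α β b : ℝ) (z : ℝ × ℝ) : modWeight α β b (-z) = modWeight α β b z := by
  have : (-z).2 - phase α β (-z).1 = -(z.2 - phase α β z.1) := by
    simp only [phase, Prod.fst_neg, Prod.snd_neg]; ring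
  unfold modWeight bracket
  rw [this, abs_neg]

/-- The squared `L²` norm of a triple convolution of nonnegative functions. -/
def tripleNorm (H₁ H₂ H₃ : ℝ × ℝ → ℝ≥0∞) : ℝ≥0∞ := ∫⁻ z, (H₁ ⋆ₗ (H₂ ⋆ₗ H₃)) z ^ 2

theorem tripleNorm_swap_right (H₁ H₂ H₃ : ℝ × ℝ → ℝ≥0∞) :
    tripleNorm H₁ H₂ H₃ = tripleNorm H₁ H₃ H₂ := by
  unfold tripleNorm; rw [lconvolution_comm (f := H₂)]

theorem tripleNorm_swap_left {H₁ H₂ H₃ : ℝ × ℝ → ℝ≥0∞} (h₁ : Measurable H₁) (h₂ : Measurable H₂)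
    (h₃ : Measurable H₃) : tripleNorm H₁ H₂ H₃ = tripleNorm H₂ H₁ H₃ := by
  unfold tripleNorm
  rw [lconvolution_assoc h₁ h₂ h₃, lconvolution_comm (f := H₁), ← lconvolution_assoc h₂ h₁ h₃]

/-- In physical space this conjugates one factor of a product, which leaves the modulus of the
product unchanged. -/
theorem tripleNorm_neg_left {H₁ H₂ H₃ : ℝ × ℝ → ℝ≥0∞} (h₁ : Measurable H₁) (h₂ : Measurable H₂)
    (h₃ : Measurable H₃) : tripleNorm (fun z ↦ H₁ (-z)) H₂ H₃ = tripleNorm H₁ H₂ H₃ := by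
  unfold tripleNorm
  rw [lconvolution_comm, lconvolution_comm (f := H₁),
    lintegral_sq_lconvolution_neg volume (by fun_prop) h₁]

theorem tripleNorm_add_left_le {H₁ H₁' H₂ H₃ : ℝ × ℝ → ℝ≥0∞} (h₁ : Measurable H₁)
    (h₁' : Measurable H₁') (h₂ : Measurable H₂) (h₃ : Measurable H₃) :
    tripleNorm (fun z ↦ H₁ z + H₁' z) H₂ H₃ ≤
      2 * (tripleNorm H₁ H₂ H₃ + tripleNorm H₁' H₂ H₃) := by
  unfold tripleNorm
  rw [lconvolution_add_left volume h₁ (by fun_prop),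
    ← lintegral_add_left ((measurable_lconvolution volume h₁ (by fun_prop)).pow_const 2),
    ← lintegral_const_mul _ (by fun_prop)]
  exact lintegral_mono fun z ↦ add_sq_le_two_mul _ _

/-- A bound for positive frequencies in the first factor extends to all frequencies. -/
theorem tripleNorm_absHalf_le {R : ℝ} (hR : 0 < R) {H₂ H₃ : ℝ × ℝ → ℝ≥0∞} (h₂ : Measurable H₂)
    (h₃ : Measurable H₃) {D : ℝ≥0∞}
    (h : ∀ F : ℝ × ℝ → ℝ≥0∞, Measurable F →
      tripleNorm (fun z ↦ posHalf R z.1 * (modWeight α β b z * F z)) H₂ H₃ ≤ D * ∫⁻ z, F z ^ 2)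
    {F : ℝ × ℝ → ℝ≥0∞} (hF : Measurable F) :
    tripleNorm (fun z ↦ absHalf R z.1 * (modWeight α β b z * F z)) H₂ H₃ ≤
      4 * D * ∫⁻ z, F z ^ 2 := by
  -- The negative-frequency half is the reflection of a function supported on positive frequencies.
  have e1 : (fun z : ℝ × ℝ ↦ absHalf R z.1 * (modWeight α β b z * F z)) = fun z ↦
      posHalf R z.1 * (modWeight α β b z * F z) +
        posHalf R (-z).1 * (modWeight α β b (-z) * F (-(-z))) := by
    ext z
    rw [absHalf_eq hR, modWeight_neg, neg_neg, Prod.fst_neg]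
    ring
  have e2 := tripleNorm_neg_left
    (H₁ := fun z : ℝ × ℝ ↦ posHalf R z.1 * (modWeight α β b z * F (-z))) (by fun_prop) h₂ h₃
  have e3 : ∫⁻ z, F (-z) ^ 2 = ∫⁻ z, F z ^ 2 := lintegral_neg_eq_self (fun z ↦ F z ^ 2)
  rw [e1]
  refine (tripleNorm_add_left_le (by fun_prop) (by fun_prop) h₂ h₃).trans ?_
  rw [e2]
  calc _ ≤ 2 * (D * (∫⁻ z, F z ^ 2) + D * ∫⁻ z, F (-z) ^ 2) := by
        gcongr
        · exact h F hF
        · exact h (fun z ↦ F (-z)) (by fun_prop)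
    _ = _ := by rw [e3]; ring

theorem trilinearForm_eq_lintegral_lconvolution {G H₁ H₂ H₃ : ℝ × ℝ → ℝ≥0∞} (hG : Measurable G)
    (h₁ : Measurable H₁) (h₂ : Measurable H₂) (h₃ : Measurable H₃) {e₁ e₂ e₃ : ℝ → ℝ≥0∞}
    (m₁ : Measurable e₁) (m₂ : Measurable e₂) (m₃ : Measurable e₃) :
    trilinearForm (fun p ↦ e₁ p.1 * e₂ p.2.1 * e₃ p.2.2) G H₁ H₂ H₃ =
      ∫⁻ z, G z * ((fun z ↦ e₁ z.1 * H₁ z) ⋆ₗ ((fun z ↦ e₂ z.1 * H₂ z) ⋆ₗ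
        (fun z ↦ e₃ z.1 * H₃ z))) z := by
  rw [lintegral_mul_lconvolution volume hG (by fun_prop) (by fun_prop) (by fun_prop)]
  unfold trilinearForm
  refine lintegral_congr fun x ↦ lintegral_congr fun y ↦ lintegral_congr fun z ↦ ?_
  ring

/-- Interactions of three comparable large frequencies. -/
theorem trilinearBound_abs {R : ℝ} (hβ : β ≠ 0) (hb : 1 / 2 < b) (hR0 : 0 < R)
    (hR : 3 * |α| ≤ |β| * R ^ 2) :
    TrilinearBound α β b fun p ↦ absHalf R p.1 * absHalf R p.2.1 * absHalf R p.2.2 := by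
  obtain ⟨C, hC⟩ := (freeBound_pos hβ hR0 hR).trilinearBound (by fun_prop) hb
  set W := modWeight α β b
  have hW : Measurable W := measurable_modWeight α β b
  -- By duality the trilinear bound becomes a bound on `tripleNorm`, where reflection is available.
  -- The sign restrictions are then removed one factor at a time, each costing a factor `4`.
  have h0 : ∀ F₁ F₂ F₃ : ℝ × ℝ → ℝ≥0∞, Measurable F₁ → Measurable F₂ → Measurable F₃ →
      tripleNorm (fun z ↦ posHalf R z.1 * (W z * F₁ z)) (fun z ↦ posHalf R z.1 * (W z * F₂ z))
        (fun z ↦ posHalf R z.1 * (W z * F₃ z)) ≤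
      (C * ((∫⁻ z, F₂ z ^ 2) * ∫⁻ z, F₃ z ^ 2)) * ∫⁻ z, F₁ z ^ 2 := by
    intro F₁ F₂ F₃ h₁ h₂ h₃
    refine lintegral_sq_le_of_pairing volume (by fun_prop) fun G hG ↦ ?_
    rw [← trilinearForm_eq_lintegral_lconvolution hG (by fun_prop) (by fun_prop) (by fun_prop)
      (by fun_prop) (by fun_prop) (by fun_prop)]
    refine (hC G F₁ F₂ F₃ hG h₁ h₂ h₃).trans (le_of_eq ?_)
    ring
  have h1 : ∀ F₁ F₂ F₃ : ℝ × ℝ → ℝ≥0∞, Measurable F₁ → Measurable F₂ → Measurable F₃ →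
      tripleNorm (fun z ↦ absHalf R z.1 * (W z * F₁ z)) (fun z ↦ posHalf R z.1 * (W z * F₂ z))
        (fun z ↦ posHalf R z.1 * (W z * F₃ z)) ≤
      (4 * C * ((∫⁻ z, F₁ z ^ 2) * ∫⁻ z, F₃ z ^ 2)) * ∫⁻ z, F₂ z ^ 2 := by
    intro F₁ F₂ F₃ h₁ h₂ h₃
    refine (tripleNorm_absHalf_le hR0 (by fun_prop) (by fun_prop)
      (fun F hF ↦ h0 F F₂ F₃ hF h₂ h₃) h₁).trans (le_of_eq ?_)
    ring
  have h2 : ∀ F₁ F₂ F₃ : ℝ × ℝ → ℝ≥0∞, Measurable F₁ → Measurable F₂ → Measurable F₃ →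
      tripleNorm (fun z ↦ absHalf R z.1 * (W z * F₁ z)) (fun z ↦ absHalf R z.1 * (W z * F₂ z))
        (fun z ↦ posHalf R z.1 * (W z * F₃ z)) ≤
      (16 * C * ((∫⁻ z, F₁ z ^ 2) * ∫⁻ z, F₂ z ^ 2)) * ∫⁻ z, F₃ z ^ 2 := by
    intro F₁ F₂ F₃ h₁ h₂ h₃
    rw [tripleNorm_swap_left (by fun_prop) (by fun_prop) (by fun_prop)]
    refine (tripleNorm_absHalf_le (D := 4 * C * ((∫⁻ z, F₁ z ^ 2) * ∫⁻ z, F₃ z ^ 2)) hR0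
      (by fun_prop) (by fun_prop) (fun F hF ↦ ?_) h₂).trans (le_of_eq ?_)
    · rw [tripleNorm_swap_left (by fun_prop) (by fun_prop) (by fun_prop)]
      exact h1 F₁ F F₃ h₁ hF h₃
    · ring
  have h3 : ∀ F₁ F₂ F₃ : ℝ × ℝ → ℝ≥0∞, Measurable F₁ → Measurable F₂ → Measurable F₃ →
      tripleNorm (fun z ↦ absHalf R z.1 * (W z * F₁ z)) (fun z ↦ absHalf R z.1 * (W z * F₂ z))
        (fun z ↦ absHalf R z.1 * (W z * F₃ z)) ≤
      64 * C * ((∫⁻ z, F₁ z ^ 2) * (∫⁻ z, F₂ z ^ 2) * ∫⁻ z, F₃ z ^ 2) := by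
    intro F₁ F₂ F₃ h₁ h₂ h₃
    rw [tripleNorm_swap_right, tripleNorm_swap_left (by fun_prop) (by fun_prop) (by fun_prop)]
    refine (tripleNorm_absHalf_le (D := 16 * C * ((∫⁻ z, F₁ z ^ 2) * ∫⁻ z, F₂ z ^ 2)) hR0
      (by fun_prop) (by fun_prop) (fun F hF ↦ ?_) h₃).trans (le_of_eq ?_)
    · rw [tripleNorm_swap_left (by fun_prop) (by fun_prop) (by fun_prop), tripleNorm_swap_right]
      exact h2 F₁ F₂ F h₁ h₂ hF
    · ring
  refine ⟨64 * C, fun G F₁ F₂ F₃ hG h₁ h₂ h₃ ↦ ?_⟩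
  rw [trilinearForm_eq_lintegral_lconvolution hG (by fun_prop) (by fun_prop) (by fun_prop)
      (by fun_prop) (by fun_prop) (by fun_prop)]
  refine (sq_lintegral_mul_le volume (by fun_prop) (by fun_prop)).trans ?_
  refine (mul_le_mul' le_rfl (h3 F₁ F₂ F₃ h₁ h₂ h₃)).trans (le_of_eq ?_)
  push_cast
  ring

/-- The symbol of the trilinear estimate. -/
def kawaharaSymbol (s : ℝ) (p : ℝ × ℝ × ℝ) : ℝ≥0∞ :=
  ENNReal.ofReal (bracket (p.1 + p.2.1 + p.2.2) ^ (s + 1) *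
    (bracket p.1 ^ (-s) * bracket p.2.1 ^ (-s) * bracket p.2.2 ^ (-s)))

theorem bracket_add_le (x y z : ℝ) : bracket (x + y + z) ≤ bracket x * bracket y * bracket z := by
  have h := (abs_add_le (x + y) z).trans (add_le_add_left (abs_add_le x y) _)
  unfold bracket
  have := abs_nonneg x
  have := abs_nonneg y
  have := abs_nonneg z
  calc 1 + |x + y + z| ≤ 1 + (|x| + |y| + |z|) := by linarith
    _ ≤ (1 + |x|) * (1 + |y|) * (1 + |z|) := by
      have h1 : 0 ≤ |x| * |y| := by positivity
      have h2 : 0 ≤ |x| * |z| := by positivity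
      have h3 : 0 ≤ |y| * |z| := by positivity
      have h4 : 0 ≤ |x| * |y| * |z| := by positivity
      nlinarith

/-- The symbol is largest for the endpoint regularity, where it is bounded by the `3/2` power of
the largest frequency. -/
theorem kawaharaSymbol_le {s : ℝ} (hs : -(1 / 4) ≤ s) {x y z N : ℝ} (hx : |x| ≤ N) (hy : |y| ≤ N)
    (hz : |z| ≤ N) (hN : 1 ≤ N) :
    kawaharaSymbol s (x, y, z) ≤ ENNReal.ofReal (8 * N ^ (3 / 2 : ℝ)) := by
  have hN0 : 0 < N := by linarith
  have b1 : bracket x ≤ 2 * N := by unfold bracket; linarith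
  have b2 : bracket y ≤ 2 * N := by unfold bracket; linarith
  have b3 : bracket z ≤ 2 * N := by unfold bracket; linarith
  have b4 : bracket (x + y + z) ≤ 4 * N := by
    have h := (abs_add_le (x + y) z).trans (add_le_add_left (abs_add_le x y) _)
    unfold bracket; linarith
  have p1 := bracket_pos x
  have p2 := bracket_pos y
  have p3 := bracket_pos z
  have p4 := bracket_pos (x + y + z)
  refine ENNReal.ofReal_le_ofReal ?_
  set X := bracket x
  set Y := bracket y
  set Z := bracket z
  set T := bracket (x + y + z)
  -- Since `s + 1 / 4 ≥ 0`, the power `T ^ (s + 1 / 4)` is split among the three frequencies. This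
  -- reduces the symbol to its value at `s = -1 / 4`.
  have hT : T ^ (s + 1) = T ^ (3 / 4 : ℝ) * T ^ (s + 1 / 4) := by
    rw [← Real.rpow_add p4]; ring_nf
  have hd : ∀ u : ℝ, 0 < u → u ^ (-s) * u ^ (s + 1 / 4) = u ^ (1 / 4 : ℝ) := fun u hu ↦ by
    rw [← Real.rpow_add hu]; ring_nf
  have hTle : T ^ (s + 1 / 4) ≤ X ^ (s + 1 / 4) * Y ^ (s + 1 / 4) * Z ^ (s + 1 / 4) := by
    rw [← Real.mul_rpow p1.le p2.le, ← Real.mul_rpow (by positivity) p3.le]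
    exact Real.rpow_le_rpow p4.le (bracket_add_le x y z) (by linarith)
  have h4 : (4 : ℝ) ^ (3 / 4 : ℝ) = 2 ^ (3 / 2 : ℝ) := by
    rw [show (4 : ℝ) = 2 ^ (2 : ℝ) by norm_num, ← Real.rpow_mul (by norm_num)]; norm_num
  calc T ^ (s + 1) * (X ^ (-s) * Y ^ (-s) * Z ^ (-s))
      ≤ T ^ (3 / 4 : ℝ) * (X ^ (s + 1 / 4) * Y ^ (s + 1 / 4) * Z ^ (s + 1 / 4)) *
        (X ^ (-s) * Y ^ (-s) * Z ^ (-s)) := by rw [hT]; gcongr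
    _ = T ^ (3 / 4 : ℝ) * ((X ^ (-s) * X ^ (s + 1 / 4)) * (Y ^ (-s) * Y ^ (s + 1 / 4)) *
        (Z ^ (-s) * Z ^ (s + 1 / 4))) := by ring
    _ = T ^ (3 / 4 : ℝ) * (X ^ (1 / 4 : ℝ) * Y ^ (1 / 4 : ℝ) * Z ^ (1 / 4 : ℝ)) := by
      rw [hd X p1, hd Y p2, hd Z p3]
    _ ≤ (4 * N) ^ (3 / 4 : ℝ) * ((2 * N) ^ (1 / 4 : ℝ) * (2 * N) ^ (1 / 4 : ℝ) *
        (2 * N) ^ (1 / 4 : ℝ)) := by gcongr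
    _ = (2 : ℝ) ^ (9 / 4 : ℝ) * N ^ (3 / 2 : ℝ) := by
      rw [Real.mul_rpow (by norm_num) hN0.le, Real.mul_rpow (by norm_num) hN0.le, h4]
      have e1 : (2 : ℝ) ^ (9 / 4 : ℝ) = 2 ^ (3 / 2 : ℝ) * (2 ^ (1 / 4 : ℝ) * 2 ^ (1 / 4 : ℝ) *
        2 ^ (1 / 4 : ℝ)) := by
        rw [← Real.rpow_add (by norm_num), ← Real.rpow_add (by norm_num),
          ← Real.rpow_add (by norm_num)]; norm_num
      have e2 : N ^ (3 / 2 : ℝ) = N ^ (3 / 4 : ℝ) * (N ^ (1 / 4 : ℝ) * N ^ (1 / 4 : ℝ) *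
        N ^ (1 / 4 : ℝ)) := by
        rw [← Real.rpow_add hN0, ← Real.rpow_add hN0, ← Real.rpow_add hN0]; norm_num
      rw [e1, e2]; ring
    _ ≤ 8 * N ^ (3 / 2 : ℝ) := by
      gcongr
      calc (2 : ℝ) ^ (9 / 4 : ℝ) ≤ 2 ^ (3 : ℝ) :=
            Real.rpow_le_rpow_of_exponent_le (by norm_num) (by norm_num)
        _ = 8 := by norm_num

end

/-! ### Decomposition of the symbol into frequency regions -/

section

open MeasureTheory

variable {α β b : ℝ}

theorem kawaharaSymbol_swap_left (s x y z : ℝ) :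
    kawaharaSymbol s (x, y, z) = kawaharaSymbol s (y, x, z) := by
  unfold kawaharaSymbol
  congr 1
  rw [add_comm x y]; ring

theorem kawaharaSymbol_swap_right (s x y z : ℝ) :
    kawaharaSymbol s (x, y, z) = kawaharaSymbol s (x, z, y) := by
  unfold kawaharaSymbol
  congr 1
  simp only [add_right_comm x y z]; ring

theorem kawaharaSymbol_le_of_max {s : ℝ} (hs : -(1 / 4) ≤ s) {x y z R : ℝ} (hR : 1 ≤ R)
    (hx : R ≤ |x|) (hy : |y| ≤ |x|) (hz : |z| ≤ |x|) :
    kawaharaSymbol s (x, y, z) ≤ 16 * (sepSymbol R (x, y, z) + sepSymbol R (x, z, y) +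
      absHalf (R / 2) x * absHalf (R / 2) y * absHalf (R / 2) z) := by
  have hx0 : 0 < |x| := by linarith
  -- The constant `8` is written as `16 / 2`; the half is used when `|y|` and `|z|` exceed `|x| /
  -- 2`, because `|x| ^ (3/2) / 2 = |x| ^ (1/2) (|x| / 2) ^ (1/2) (|x| / 2) ^ (1/2)`.
  have h8 : kawaharaSymbol s (x, y, z) ≤ 16 * ENNReal.ofReal (|x| ^ (3 / 2 : ℝ) / 2) := by
    refine (kawaharaSymbol_le hs le_rfl hy hz (hR.trans hx)).trans (le_of_eq ?_)
    rw [show (16 : ℝ≥0∞) = ENNReal.ofReal 16 by simp, ← ENNReal.ofReal_mul (by norm_num)]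
    congr 1; ring
  have hhalf : ENNReal.ofReal (|x| ^ (3 / 2 : ℝ) / 2) ≤ ENNReal.ofReal (|x| ^ (3 / 2 : ℝ)) :=
    ENNReal.ofReal_le_ofReal (half_le_self (by positivity))
  refine h8.trans (mul_le_mul_right ?_ _)
  by_cases h1 : |z| ≤ |x| / 2
  · refine le_trans ?_ (le_trans le_self_add le_self_add)
    rw [sepSymbol, Set.indicator_of_mem (by exact ⟨hx, hy, h1⟩)]
    exact hhalf
  by_cases h2 : |y| ≤ |x| / 2
  · refine le_trans ?_ (le_trans le_add_self le_self_add)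
    rw [sepSymbol, Set.indicator_of_mem (by exact ⟨hx, hz, h2⟩)]
    exact hhalf
  · refine le_trans ?_ le_add_self
    push Not at h1 h2
    have k1 : R / 2 ≤ |x| := by linarith
    have k2 : R / 2 ≤ |y| := by linarith
    have k3 : R / 2 ≤ |z| := by linarith
    rw [absHalf, absHalf, absHalf, Set.indicator_of_mem (by exact k1),
      Set.indicator_of_mem (by exact k2), Set.indicator_of_mem (by exact k3),
      ← ENNReal.ofReal_mul (by positivity), ← ENNReal.ofReal_mul (by positivity)]
    refine ENNReal.ofReal_le_ofReal ?_
    have e : |x| ^ (3 / 2 : ℝ) / 2 =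
        |x| ^ (1 / 2 : ℝ) * (|x| / 2) ^ (1 / 2 : ℝ) * (|x| / 2) ^ (1 / 2 : ℝ) := by
      rw [mul_assoc, ← Real.rpow_add (by positivity)]
      norm_num
      rw [← mul_div_assoc, ← Real.rpow_add_one hx0.ne']
      norm_num
    rw [e]
    gcongr

/-- Boundedness of the trilinear form with the symbol of the trilinear estimate. -/
theorem trilinearBound_kawaharaSymbol (α : ℝ) (hβ : β ≠ 0) {s : ℝ} (hs : -(1 / 4) ≤ s)
    (hb : 1 / 2 < b) : TrilinearBound α β b (kawaharaSymbol s) := by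
  have hβ' : 0 < |β| := abs_pos.2 hβ
  obtain ⟨r, hr1, hr⟩ : ∃ r : ℝ, 1 ≤ r ∧ 3 * |α| ≤ |β| * r ^ 2 := by
    refine ⟨1 + 3 * |α| / |β|, by simp; positivity, ?_⟩
    have h0 : 0 ≤ 3 * |α| / |β| := by positivity
    calc 3 * |α| = |β| * (3 * |α| / |β|) := by field_simp
      _ ≤ _ := by gcongr; nlinarith
  -- In the comparable region the largest frequency is at least `R` and the others at least `R / 2`,
  -- so the condition on the phase is required already at `R / 2 = r`.
  set R := 2 * r with hRdef
  have hR : 3 * |α| ≤ |β| * R ^ 2 := hr.trans (by gcongr; linarith)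
  have hR1 : 1 ≤ R := by linarith
  have hR2 : R / 2 = r := by rw [hRdef]; ring
  set M₀ := sepSymbol R
  have m₀ : Measurable M₀ := measurable_sepSymbol R
  have t₀ : TrilinearBound α β b M₀ := (freeBound_sep hβ hR1 hR).trilinearBound m₀ hb
  -- Together with `t₀`, these are the six choices of which frequency is largest and which is small.
  have t₁ := t₀.swap_right m₀
  have t₂ := t₀.swap_left m₀
  have t₃ := t₁.swap_left (by fun_prop)
  have t₄ := t₂.swap_right (by fun_prop)
  have t₅ := t₃.swap_right (by fun_prop)
  have t₆ := trilinearBound_abs (α := α) (b := b) hβ hb (by linarith) hr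
  have t₇ := trilinearBound_low α β hb R
  have m₇ : Measurable (Set.indicator {p : ℝ × ℝ × ℝ | |p.1| ≤ R ∧ |p.2.1| ≤ R ∧ |p.2.2| ≤ R}
      (1 : ℝ × ℝ × ℝ → ℝ≥0∞)) := by
    refine measurable_one.indicator ?_
    change MeasurableSet ({p : ℝ × ℝ × ℝ | |p.1| ≤ R} ∩ ({p : ℝ × ℝ × ℝ | |p.2.1| ≤ R} ∩
      {p : ℝ × ℝ × ℝ | |p.2.2| ≤ R}))
    exact (measurableSet_le (by fun_prop) (by fun_prop)).inter
      ((measurableSet_le (by fun_prop) (by fun_prop)).inter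
        (measurableSet_le (by fun_prop) (by fun_prop)))
  have sum := ((((((t₇.add t₀ m₇).add t₁ (by fun_prop)).add t₂ (by fun_prop)).add t₃
    (by fun_prop)).add t₄ (by fun_prop)).add t₅ (by fun_prop)).add t₆ (by fun_prop)
  refine sum.mono (by fun_prop) (Real.toNNReal (8 * R ^ (3 / 2 : ℝ)) + 16) fun ⟨x, y, z⟩ ↦ ?_
  dsimp only
  rw [ENNReal.coe_add, ENNReal.ofNNReal_toNNReal]
  set low := Set.indicator {p : ℝ × ℝ × ℝ | |p.1| ≤ R ∧ |p.2.1| ≤ R ∧ |p.2.2| ≤ R}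
    (1 : ℝ × ℝ × ℝ → ℝ≥0∞) (x, y, z) with hlow
  by_cases hle : |x| ≤ R ∧ |y| ≤ R ∧ |z| ≤ R
  · have h1 : low = 1 := by rw [hlow, Set.indicator_of_mem (by exact hle)]; rfl
    rw [h1]
    refine (kawaharaSymbol_le hs hle.1 hle.2.1 hle.2.2 hR1).trans ?_
    refine le_trans (le_of_eq (mul_one _).symm) (mul_le_mul' le_self_add ?_)
    simp only [add_assoc]
    exact le_self_add
  · refine le_trans ?_ (mul_le_mul_left (le_add_self : ((16 : ℝ≥0) : ℝ≥0∞) ≤ _) _)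
    have finish : ∀ {x y z : ℝ} (T : ℝ≥0∞), R ≤ |x| → |y| ≤ |x| → |z| ≤ |x| →
        M₀ (x, y, z) + M₀ (x, z, y) + absHalf r x * absHalf r y * absHalf r z ≤ T →
        kawaharaSymbol s (x, y, z) ≤ ((16 : ℝ≥0) : ℝ≥0∞) * T := by
      intro x y z T hx hy hz hT
      refine (kawaharaSymbol_le_of_max hs hR1 hx hy hz).trans ?_
      rw [hR2]
      push_cast
      gcongr
    have dom : ∀ a₀ a₁ a₂ a₃ a₄ a₅ a₆ : ℝ≥0∞,
        a₀ + a₁ + a₆ ≤ low + a₀ + a₁ + a₂ + a₃ + a₄ + a₅ + a₆ ∧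
        a₂ + a₃ + a₆ ≤ low + a₀ + a₁ + a₂ + a₃ + a₄ + a₅ + a₆ ∧
        a₄ + a₅ + a₆ ≤ low + a₀ + a₁ + a₂ + a₃ + a₄ + a₅ + a₆ := by
      intro a₀ a₁ a₂ a₃ a₄ a₅ a₆
      refine ⟨?_, ?_, ?_⟩
      · calc _ ≤ (a₀ + a₁ + a₆) + (low + a₂ + a₃ + a₄ + a₅) := le_self_add
          _ = _ := by ring
      · calc _ ≤ (a₂ + a₃ + a₆) + (low + a₀ + a₁ + a₄ + a₅) := le_self_add
          _ = _ := by ring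
      · calc _ ≤ (a₄ + a₅ + a₆) + (low + a₀ + a₁ + a₂ + a₃) := le_self_add
          _ = _ := by ring
    have big : R ≤ |x| ∨ R ≤ |y| ∨ R ≤ |z| := by
      by_contra hcon
      push Not at hcon
      exact hle ⟨hcon.1.le, hcon.2.1.le, hcon.2.2.le⟩
    have hmax : (|y| ≤ |x| ∧ |z| ≤ |x|) ∨ (|x| ≤ |y| ∧ |z| ≤ |y|) ∨ (|x| ≤ |z| ∧ |y| ≤ |z|) := by
      rcases le_total |x| |y| with h | h <;> rcases le_total |y| |z| with h' | h' <;>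
        rcases le_total |x| |z| with h'' | h'' <;>
        first
        | exact Or.inl ⟨by linarith, by linarith⟩
        | exact Or.inr (Or.inl ⟨by linarith, by linarith⟩)
        | exact Or.inr (Or.inr ⟨by linarith, by linarith⟩)
    rcases hmax with ⟨h1, h2⟩ | ⟨h1, h2⟩ | ⟨h1, h2⟩
    · have hx : R ≤ |x| := by rcases big with h | h | h <;> linarith
      exact finish _ hx h1 h2 (dom _ _ _ _ _ _ _).1
    · have hx : R ≤ |y| := by rcases big with h | h | h <;> linarith
      rw [kawaharaSymbol_swap_left]
      refine finish _ hx h1 h2 (le_trans (le_of_eq ?_) (dom _ _ _ _ _ _ _).2.1)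
      rw [mul_comm (absHalf r y)]
    · have hx : R ≤ |z| := by rcases big with h | h | h <;> linarith
      rw [kawaharaSymbol_swap_right, kawaharaSymbol_swap_left]
      refine finish _ hx h1 h2 (le_trans (le_of_eq ?_) (dom _ _ _ _ _ _ _).2.2)
      rw [mul_comm (absHalf r z), mul_right_comm]

end

/-! ### The weighted convolution estimate, and its transfer to the plane -/

section

open MeasureTheory

/-- Weighted `L²` bound for triple convolutions of nonnegative functions on `ℝ × ℝ`. -/
theorem lintegral_sq_weight_lconvolution_le (α : ℝ) {β s b : ℝ} (hβ : β ≠ 0)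
    (hs : -(1 / 4) ≤ s) (hb : 1 / 2 < b) :
    ∃ C : ℝ≥0, ∀ H₁ H₂ H₃ : ℝ × ℝ → ℝ≥0∞, Measurable H₁ → Measurable H₂ → Measurable H₃ →
      ∫⁻ z, (ENNReal.ofReal (bracket z.1 ^ (s + 1)) * (H₁ ⋆ₗ (H₂ ⋆ₗ H₃)) z) ^ 2 ≤
        C * ((∫⁻ z, (ENNReal.ofReal (weight α β s b z.1 z.2) * H₁ z) ^ 2) *
          (∫⁻ z, (ENNReal.ofReal (weight α β s b z.1 z.2) * H₂ z) ^ 2) *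
          ∫⁻ z, (ENNReal.ofReal (weight α β s b z.1 z.2) * H₃ z) ^ 2) := by
  obtain ⟨C, hC⟩ := trilinearBound_kawaharaSymbol α hβ hs hb
  refine ⟨C, fun H₁ H₂ H₃ h₁ h₂ h₃ ↦ ?_⟩
  set w : ℝ × ℝ → ℝ≥0∞ := fun z ↦ ENNReal.ofReal (weight α β s b z.1 z.2) with hw
  have hwm : Measurable w := by simp only [hw, weight]; fun_prop
  set e : ℝ → ℝ≥0∞ := fun ξ ↦ ENNReal.ofReal (bracket ξ ^ (-s)) with he
  have hem : Measurable e := by fun_prop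
  -- The factors `⟨ξ⟩ ^ (-s)` and `⟨τ - p(ξ)⟩ ^ (-b)` undo the weight, so the trilinear form
  -- evaluates the convolution of the original functions.
  have hcancel : ∀ H : ℝ × ℝ → ℝ≥0∞,
      (fun z ↦ e z.1 * (modWeight α β b z * (w z * H z))) = H := fun H ↦ by
    ext z
    have h1 : e z.1 * (modWeight α β b z * w z) = 1 := by
      have p1 := bracket_pos z.1
      have p2 := bracket_pos (z.2 - phase α β z.1)
      simp only [he, modWeight, hw, weight]
      rw [← ENNReal.ofReal_mul (by positivity), ← ENNReal.ofReal_mul (by positivity),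
        Real.rpow_neg p1.le, Real.rpow_neg p2.le]
      rw [← ENNReal.ofReal_one]
      congr 1
      field_simp
    calc _ = (e z.1 * (modWeight α β b z * w z)) * H z := by ring
      _ = H z := by rw [h1, one_mul]
  refine lintegral_sq_le_of_pairing volume (by fun_prop) fun G hG ↦ ?_
  have key := hC G (fun z ↦ w z * H₁ z) (fun z ↦ w z * H₂ z) (fun z ↦ w z * H₃ z) hG
    (by fun_prop) (by fun_prop) (by fun_prop)
  have e1 := trilinearForm_eq_lintegral_lconvolution
    (G := fun z ↦ ENNReal.ofReal (bracket z.1 ^ (s + 1)) * G z)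
    (H₁ := fun z ↦ modWeight α β b z * (w z * H₁ z))
    (H₂ := fun z ↦ modWeight α β b z * (w z * H₂ z))
    (H₃ := fun z ↦ modWeight α β b z * (w z * H₃ z)) (by fun_prop) (by fun_prop) (by fun_prop)
    (by fun_prop) hem hem hem
  rw [hcancel, hcancel, hcancel] at e1
  have e2 : trilinearForm (kawaharaSymbol s) G (fun z ↦ modWeight α β b z * (w z * H₁ z))
      (fun z ↦ modWeight α β b z * (w z * H₂ z)) (fun z ↦ modWeight α β b z * (w z * H₃ z)) =
      ∫⁻ z, G z * (ENNReal.ofReal (bracket z.1 ^ (s + 1)) * (H₁ ⋆ₗ (H₂ ⋆ₗ H₃)) z) := by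
    calc _ = _ := by
          unfold trilinearForm
          refine lintegral_congr fun x ↦ lintegral_congr fun y ↦ lintegral_congr fun z ↦ ?_
          have : kawaharaSymbol s (x.1, y.1, z.1) = e x.1 * e y.1 * e z.1 *
              ENNReal.ofReal (bracket (x + y + z).1 ^ (s + 1)) := by
            have p1 := bracket_pos x.1
            have p2 := bracket_pos y.1
            have p3 := bracket_pos z.1
            have p4 := bracket_pos (x.1 + y.1 + z.1)
            simp only [kawaharaSymbol, he, Prod.fst_add]
            rw [ENNReal.ofReal_mul (by positivity), ENNReal.ofReal_mul (by positivity),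
              ENNReal.ofReal_mul (by positivity)]
            ring
          rw [this, mul_assoc (e x.1 * e y.1 * e z.1)]
      _ = _ := e1
      _ = _ := lintegral_congr fun z ↦ by ring
  rw [e2] at key
  refine key.trans (le_of_eq ?_)
  ring

/-- The point of the plane with given coordinates. -/
def toPlane (z : ℝ × ℝ) : Plane := WithLp.toLp 2 ![z.1, z.2]

@[simp] theorem toPlane_zero_apply (z : ℝ × ℝ) : toPlane z 0 = z.1 := rfl

@[simp] theorem toPlane_one_apply (z : ℝ × ℝ) : toPlane z 1 = z.2 := rfl

theorem measurePreserving_toPlane : MeasurePreserving toPlane :=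
  (PiLp.volume_preserving_toLp (Fin 2)).comp (volume_preserving_finTwoArrow ℝ).symm

theorem toPlane_neg_add (z w : ℝ × ℝ) : toPlane (-z + w) = -toPlane z + toPlane w := by
  ext i
  fin_cases i <;> simp [toPlane]

theorem lconvolution_toPlane {H₁ H₂ : Plane → ℝ≥0∞} (h₁ : Measurable H₁) (h₂ : Measurable H₂) :
    (fun z ↦ (H₁ ⋆ₗ H₂) (toPlane z)) = (fun z ↦ H₁ (toPlane z)) ⋆ₗ (fun z ↦ H₂ (toPlane z)) := by
  ext z
  rw [lconvolution_def, lconvolution_def,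
    ← measurePreserving_toPlane.lintegral_comp (by fun_prop)]
  simp only [toPlane_neg_add]

theorem bracket_two_pi_mul_le (r : ℝ) : bracket (2 * Real.pi * r) ≤ 2 * Real.pi * bracket r := by
  have := Real.pi_gt_three
  unfold bracket
  rw [abs_mul, abs_of_pos (show 0 < 2 * Real.pi by positivity)]
  linarith

theorem bracket_le_bracket_two_pi_mul (r : ℝ) : bracket r ≤ bracket (2 * Real.pi * r) := by
  have := Real.pi_gt_three
  unfold bracket
  rw [abs_mul, abs_of_pos (show 0 < 2 * Real.pi by positivity)]
  nlinarith [abs_nonneg r]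

/-- Dilation by `2π` carries the phase to one of the same family with rescaled coefficients. The
exponent `|s|` covers both signs of `s`, while for `b ≥ 0` the modulation bracket only grows. -/
theorem weight_le_mul_weight_two_pi (α β s : ℝ) {b : ℝ} (hb : 0 ≤ b) (x t : ℝ) :
    weight (α * (2 * Real.pi) ^ 2) (β * (2 * Real.pi) ^ 4) s b x t ≤
      (2 * Real.pi) ^ |s| * weight α β s b (2 * Real.pi * x) (2 * Real.pi * t) := by
  have hpi := Real.pi_gt_three
  have h1 : bracket x ^ s ≤ (2 * Real.pi) ^ |s| * bracket (2 * Real.pi * x) ^ s := by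
    have p1 := bracket_pos x
    have p2 := bracket_pos (2 * Real.pi * x)
    rcases le_total 0 s with h | h
    · calc bracket x ^ s ≤ 1 * bracket (2 * Real.pi * x) ^ s := by
            rw [one_mul]
            exact Real.rpow_le_rpow p1.le (bracket_le_bracket_two_pi_mul x) h
        _ ≤ _ := by
            gcongr
            exact Real.one_le_rpow (by linarith) (abs_nonneg s)
    · have h2 := Real.rpow_le_rpow_of_nonpos p2 (bracket_two_pi_mul_le x) h
      rw [Real.mul_rpow (by positivity) p1.le] at h2
      calc bracket x ^ s = (2 * Real.pi) ^ (-s) * ((2 * Real.pi) ^ s * bracket x ^ s) := by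
            rw [← mul_assoc, ← Real.rpow_add (by positivity)]; simp
        _ ≤ _ := by rw [abs_of_nonpos h]; gcongr
  have h3 : 2 * Real.pi * t - phase α β (2 * Real.pi * x) =
      2 * Real.pi * (t - phase (α * (2 * Real.pi) ^ 2) (β * (2 * Real.pi) ^ 4) x) := by
    unfold phase; ring
  unfold weight
  rw [h3, ← mul_assoc]
  have p3 := bracket_pos (t - phase (α * (2 * Real.pi) ^ 2) (β * (2 * Real.pi) ^ 4) x)
  have p4 := bracket_pos (2 * Real.pi * x)
  have p5 := bracket_pos x
  gcongr
  exact bracket_le_bracket_two_pi_mul _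

/-- The Bourgain weight as a function on the Fourier side. -/
def bourgainWeight (α β s b : ℝ) (ζ : Plane) : ℝ≥0∞ :=
  ENNReal.ofReal (weight α β s b (2 * Real.pi * ζ 0) (2 * Real.pi * ζ 1))

@[fun_prop]
theorem measurable_bourgainWeight (α β s b : ℝ) : Measurable (bourgainWeight α β s b) := by
  unfold bourgainWeight weight; fun_prop

/-- Weighted `L²` bound for triple convolutions of nonnegative functions on the plane. -/
theorem lintegral_sq_lconvolution_plane_le (α : ℝ) {β s b : ℝ} (hβ : β ≠ 0)
    (hs : -(1 / 4) ≤ s) (hb : 1 / 2 < b) :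
    ∃ C : ℝ≥0, ∀ H₁ H₂ H₃ : Plane → ℝ≥0∞, Measurable H₁ → Measurable H₂ → Measurable H₃ →
      ∫⁻ ζ, (ENNReal.ofReal (bracket (2 * Real.pi * ζ 0) ^ (s + 1)) *
        (H₁ ⋆ₗ (H₂ ⋆ₗ H₃)) ζ) ^ 2 ≤
        C * ((∫⁻ ζ, (bourgainWeight α β s b ζ * H₁ ζ) ^ 2) *
          (∫⁻ ζ, (bourgainWeight α β s b ζ * H₂ ζ) ^ 2) *
          ∫⁻ ζ, (bourgainWeight α β s b ζ * H₃ ζ) ^ 2) := by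
  have hpi := Real.pi_gt_three
  -- The convolution is in the ordinary frequencies `ζ` and the weights in the angular ones `2π ζ`;
  -- the rescaled coefficients match the two.
  obtain ⟨C, hC⟩ := lintegral_sq_weight_lconvolution_le (α * (2 * Real.pi) ^ 2)
    (β := β * (2 * Real.pi) ^ 4) (mul_ne_zero hβ (by positivity)) hs hb
  set c : ℝ≥0 := Real.toNNReal ((2 * Real.pi) ^ (s + 1)) with hc
  set d : ℝ≥0 := Real.toNNReal ((2 * Real.pi) ^ |s|) with hd
  refine ⟨c ^ 2 * (C * d ^ 6), fun H₁ H₂ H₃ h₁ h₂ h₃ ↦ ?_⟩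
  have hw : ∀ H : Plane → ℝ≥0∞, Measurable H →
      ∫⁻ z : ℝ × ℝ, (ENNReal.ofReal (weight (α * (2 * Real.pi) ^ 2) (β * (2 * Real.pi) ^ 4) s b
        z.1 z.2) * H (toPlane z)) ^ 2 ≤ d ^ 2 * ∫⁻ ζ, (bourgainWeight α β s b ζ * H ζ) ^ 2 := by
    intro H hH
    rw [← measurePreserving_toPlane.lintegral_comp (by fun_prop)]
    have hm := measurePreserving_toPlane.measurable
    rw [← lintegral_const_mul _ (by fun_prop)]
    refine lintegral_mono fun z ↦ ?_
    rw [← mul_pow, ← mul_assoc]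
    gcongr
    rw [bourgainWeight, hd, ENNReal.ofNNReal_toNNReal, ← ENNReal.ofReal_mul (by positivity)]
    exact ENNReal.ofReal_le_ofReal (weight_le_mul_weight_two_pi α β s (by linarith) _ _)
  rw [← measurePreserving_toPlane.lintegral_comp (by fun_prop)]
  have hm := measurePreserving_toPlane.measurable
  have e1 : ∀ z, (H₁ ⋆ₗ (H₂ ⋆ₗ H₃)) (toPlane z) = ((fun z ↦ H₁ (toPlane z)) ⋆ₗ
      ((fun z ↦ H₂ (toPlane z)) ⋆ₗ (fun z ↦ H₃ (toPlane z)))) z := fun z ↦ by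
    rw [← lconvolution_toPlane h₂ h₃, ← lconvolution_toPlane h₁ (by fun_prop)]
  have k1 : Measurable fun z ↦ H₁ (toPlane z) := by fun_prop
  have k2 : Measurable fun z ↦ H₂ (toPlane z) := by fun_prop
  have k3 : Measurable fun z ↦ H₃ (toPlane z) := by fun_prop
  simp only [e1, toPlane_zero_apply]
  calc _ ≤ ∫⁻ z : ℝ × ℝ, c ^ 2 * (ENNReal.ofReal (bracket z.1 ^ (s + 1)) *
        ((fun z ↦ H₁ (toPlane z)) ⋆ₗ ((fun z ↦ H₂ (toPlane z)) ⋆ₗ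
          (fun z ↦ H₃ (toPlane z)))) z) ^ 2 := by
        refine lintegral_mono fun z ↦ ?_
        rw [← mul_pow, ← mul_assoc]
        gcongr
        rw [hc, ENNReal.ofNNReal_toNNReal, ← ENNReal.ofReal_mul (by positivity),
          ← Real.mul_rpow (by positivity) (bracket_pos _).le]
        exact ENNReal.ofReal_le_ofReal (Real.rpow_le_rpow (bracket_pos _).le
          (bracket_two_pi_mul_le _) (by linarith))
    _ ≤ c ^ 2 * (C * ((d ^ 2 * ∫⁻ ζ, (bourgainWeight α β s b ζ * H₁ ζ) ^ 2) *
          (d ^ 2 * ∫⁻ ζ, (bourgainWeight α β s b ζ * H₂ ζ) ^ 2) *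
          (d ^ 2 * ∫⁻ ζ, (bourgainWeight α β s b ζ * H₃ ζ) ^ 2))) := by
        rw [lintegral_const_mul _ (by fun_prop)]
        refine mul_le_mul' le_rfl ((hC _ _ _ k1 k2 k3).trans ?_)
        gcongr
        · exact hw H₁ h₁
        · exact hw H₂ h₂
        · exact hw H₃ h₃
    _ = _ := by push_cast; ring

end

/-! ### Functions representing distributions, Fourier inversion, and convolution -/

section

open MeasureTheory Convolution

theorem Represents.congr {f g : Plane → ℂ} {U : 𝓢'(Plane, ℂ)} (h : Represents f U)
    (hfg : f =ᵐ[volume] g) : Represents g U := by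
  refine ⟨h.1.congr hfg, fun φ ↦ ?_⟩
  have e : (fun z ↦ φ z * f z) =ᵐ[volume] fun z ↦ φ z * g z := by
    filter_upwards [hfg] with z hz
    rw [hz]
  exact ⟨(h.2 φ).1.congr e, (h.2 φ).2.trans (integral_congr_ae e)⟩

/-- Near a given point, `f` coincides with its product with a bump function equal to one on a ball,
and this product is integrable. -/
theorem Represents.locallyIntegrable {f : Plane → ℂ} {U : 𝓢'(Plane, ℂ)} (h : Represents f U) :
    LocallyIntegrable f := by
  intro x
  let φ : ContDiffBump x := ⟨1, 2, one_pos, one_lt_two⟩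
  have h₁ : HasCompactSupport (Complex.ofRealCLM ∘ φ) := φ.hasCompactSupport.comp_left rfl
  have h₂ : ContDiff ℝ (⊤ : ℕ∞) (Complex.ofRealCLM ∘ φ) :=
    Complex.ofRealCLM.contDiff.comp φ.contDiff
  refine ⟨Metric.closedBall x 1, Metric.closedBall_mem_nhds x one_pos, ?_⟩
  refine ((h.2 (h₁.toSchwartzMap h₂)).1.integrableOn (s := Metric.closedBall x 1)).congr_fun ?_
    measurableSet_closedBall
  intro z hz
  have : φ z = 1 := φ.one_of_mem_closedBall hz
  simp [this]

theorem Represents.ae_eq {f g : Plane → ℂ} {U : 𝓢'(Plane, ℂ)} (hf : Represents f U)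
    (hg : Represents g U) : f =ᵐ[volume] g := by
  refine ae_eq_of_integral_contDiff_smul_eq hf.locallyIntegrable hg.locallyIntegrable ?_
  intro φ φ_smooth φ_cpt
  have h₁ : HasCompactSupport (Complex.ofRealCLM ∘ φ) := φ_cpt.comp_left rfl
  have h₂ : ContDiff ℝ (⊤ : ℕ∞) (Complex.ofRealCLM ∘ φ) := by fun_prop
  have k1 := (hf.2 (h₁.toSchwartzMap h₂)).2
  have k2 := (hg.2 (h₁.toSchwartzMap h₂)).2
  simpa using k1.symm.trans k2

/-- A Schwartz function lies in the Lebesgue space of the conjugate exponent, so Hölder's inequality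
gives integrability. -/
theorem represents_toTemperedDistribution {p : ℝ≥0∞} [hp : Fact (1 ≤ p)]
    (f : Lp ℂ p (volume : Measure Plane)) : Represents f (Lp.toTemperedDistribution f) := by
  refine ⟨(Lp.aestronglyMeasurable f), fun φ ↦ ⟨?_, by simp⟩⟩
  have : ENNReal.HolderConjugate p (1 - p⁻¹)⁻¹ :=
    ENNReal.HolderConjugate.inv_one_sub_inv' hp.out
  have h := MemLp.integrable_mul (φ.memLp (1 - p⁻¹)⁻¹ volume) (Lp.memLp f)
  exact h

/-- Fubini for the inverse Fourier transform. -/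
theorem integral_mul_fourierInv_eq {f g : Plane → ℂ} (hf : Integrable f) (hg : Integrable g) :
    ∫ z, g z * 𝓕⁻ f z = ∫ z, 𝓕⁻ g z * f z := by
  have h := VectorFourier.integral_fourierIntegral_smul_eq_flip (μ := (volume : Measure Plane))
    (ν := (volume : Measure Plane)) (L := -innerₗ Plane) (f := f) (g := g)
    Real.continuous_fourierChar (by
      simp only [LinearMap.neg_apply, innerₗ_apply_apply]
      fun_prop) hf hg
  have e : (-innerₗ Plane).flip = -innerₗ Plane := by
    ext x y
    simp [real_inner_comm]
  rw [e] at h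
  simp only [smul_eq_mul] at h
  calc ∫ z, g z * 𝓕⁻ f z = ∫ z, 𝓕⁻ f z * g z := by simp_rw [mul_comm]
    _ = ∫ z, f z * 𝓕⁻ g z := h
    _ = _ := by simp_rw [mul_comm]

theorem continuous_fourierInv {f : Plane → ℂ} (hf : Integrable f) : Continuous (𝓕⁻ f) :=
  VectorFourier.fourierIntegral_continuous Real.continuous_fourierChar (L := -innerₗ Plane) (by
      simp only [LinearMap.neg_apply, innerₗ_apply_apply]
      fun_prop) hf

theorem norm_fourierInv_le {f : Plane → ℂ} (z : Plane) : ‖𝓕⁻ f z‖ ≤ ∫ w, ‖f w‖ :=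
  VectorFourier.norm_fourierIntegral_le_integral_norm _ _ _ _ _

/-- The inverse Fourier integral of an `L¹ ∩ L²` function agrees with the inverse Fourier transform
on `L²`. -/
theorem fourierInv_ae_eq_of_memLp_two {f : Plane → ℂ} (hf : Integrable f) (hf2 : MemLp f 2) :
    𝓕⁻ f =ᵐ[volume] (𝓕⁻ (hf2.toLp f) : Lp ℂ 2 (volume : Measure Plane)) := by
  have h1 := represents_toTemperedDistribution (𝓕⁻ (hf2.toLp f))
  -- Both functions represent the same tempered distribution, the first by Fubini.
  refine Represents.ae_eq (U := Lp.toTemperedDistribution (𝓕⁻ (hf2.toLp f))) ⟨?_, fun φ ↦ ⟨?_, ?_⟩⟩ h1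
  · exact (continuous_fourierInv hf).aestronglyMeasurable
  · exact (φ.integrable).mul_bdd (continuous_fourierInv hf).aestronglyMeasurable
      (Filter.Eventually.of_forall fun z ↦ norm_fourierInv_le z)
  · rw [← Lp.fourierInv_toTemperedDistribution_eq, TemperedDistribution.fourierInv_apply,
      Lp.toTemperedDistribution_apply, integral_mul_fourierInv_eq hf φ.integrable,
      SchwartzMap.fourierInv_coe]
    refine integral_congr_ae ?_
    filter_upwards [hf2.coeFn_toLp] with z hz
    rw [hz, smul_eq_mul]

theorem memLp_fourierInv {f : Plane → ℂ} (hf : Integrable f) (hf2 : MemLp f 2) :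
    MemLp (𝓕⁻ f) 2 :=
  (memLp_congr_ae (fourierInv_ae_eq_of_memLp_two hf hf2)).2 (Lp.memLp _)

theorem fourier_toLp_fourierInv {f : Plane → ℂ} (hf : Integrable f) (hf2 : MemLp f 2) :
    𝓕 ((memLp_fourierInv hf hf2).toLp (𝓕⁻ f)) = hf2.toLp f := by
  have : (memLp_fourierInv hf hf2).toLp (𝓕⁻ f) = 𝓕⁻ (hf2.toLp f) := by
    rw [← Lp.toLp_coeFn (𝓕⁻ (hf2.toLp f)) (Lp.memLp _)]
    exact MemLp.toLp_congr _ _ (fourierInv_ae_eq_of_memLp_two hf hf2)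
  rw [this, FourierTransform.fourier_fourierInv_eq]

theorem eLpNorm_fourierInv {f : Plane → ℂ} (hf : Integrable f) (hf2 : MemLp f 2) :
    eLpNorm (𝓕⁻ f) 2 volume = eLpNorm f 2 volume := by
  have h := Lp.norm_fourier_eq ((memLp_fourierInv hf hf2).toLp (𝓕⁻ f))
  rw [fourier_toLp_fourierInv hf hf2, Lp.norm_toLp, Lp.norm_toLp] at h
  exact ((ENNReal.toReal_eq_toReal_iff' hf2.eLpNorm_ne_top
    (memLp_fourierInv hf hf2).eLpNorm_ne_top).1 h).symm

theorem fourierInv_mul {f g : Plane → ℂ} (hf : Integrable f) (hg : Integrable g) (z : Plane) :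
    𝓕⁻ (f ⋆[ContinuousLinearMap.mul ℂ ℂ] g) z = 𝓕⁻ f z * 𝓕⁻ g z := by
  rw [Real.fourierInv_eq_fourier_neg, Real.fourierInv_eq_fourier_neg,
    Real.fourierInv_eq_fourier_neg, Real.fourier_mul_convolution_eq hf hg]

theorem enorm_convolution_le (f g : Plane → ℂ) (z : Plane) :
    ‖(f ⋆[ContinuousLinearMap.mul ℂ ℂ] g) z‖ₑ ≤ ((fun z ↦ ‖f z‖ₑ) ⋆ₗ (fun z ↦ ‖g z‖ₑ)) z := by
  rw [convolution_def, lconvolution_def]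
  refine (enorm_integral_le_lintegral_enorm _).trans (le_of_eq ?_)
  refine lintegral_congr fun y ↦ ?_
  simp [sub_eq_neg_add]

theorem lconvolution_mono {H₁ H₂ H₁' H₂' : Plane → ℝ≥0∞} (h : ∀ z, H₁ z ≤ H₁' z)
    (h' : ∀ z, H₂ z ≤ H₂' z) (z : Plane) :
    (H₁ ⋆ₗ H₂) z ≤ (H₁' ⋆ₗ H₂') z := by
  rw [lconvolution_def, lconvolution_def]
  gcongr
  · exact h _
  · exact h' _

/-- The convolution of three functions. -/
def tripleConvolution (f₁ f₂ f₃ : Plane → ℂ) : Plane → ℂ :=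
  f₁ ⋆[ContinuousLinearMap.mul ℂ ℂ] (f₂ ⋆[ContinuousLinearMap.mul ℂ ℂ] f₃)

theorem integrable_tripleConvolution {f₁ f₂ f₃ : Plane → ℂ} (h₁ : Integrable f₁)
    (h₂ : Integrable f₂) (h₃ : Integrable f₃) : Integrable (tripleConvolution f₁ f₂ f₃) :=
  h₁.integrable_convolution _ (h₂.integrable_convolution _ h₃)

theorem fourierInv_tripleConvolution {f₁ f₂ f₃ : Plane → ℂ} (h₁ : Integrable f₁)
    (h₂ : Integrable f₂) (h₃ : Integrable f₃) :
    𝓕⁻ (tripleConvolution f₁ f₂ f₃) = fun z ↦ 𝓕⁻ f₁ z * 𝓕⁻ f₂ z * 𝓕⁻ f₃ z := by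
  ext z
  rw [tripleConvolution, fourierInv_mul h₁ (h₂.integrable_convolution _ h₃),
    fourierInv_mul h₂ h₃, mul_assoc]

theorem enorm_tripleConvolution_le (f₁ f₂ f₃ : Plane → ℂ) (z : Plane) :
    ‖tripleConvolution f₁ f₂ f₃ z‖ₑ ≤
      ((fun z ↦ ‖f₁ z‖ₑ) ⋆ₗ ((fun z ↦ ‖f₂ z‖ₑ) ⋆ₗ (fun z ↦ ‖f₃ z‖ₑ))) z :=
  (enorm_convolution_le _ _ _).trans
    (lconvolution_mono (fun _ ↦ le_rfl) (enorm_convolution_le f₂ f₃) z)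

theorem eLpNorm_two_sq {X E : Type*} [MeasurableSpace X] [NormedAddCommGroup E] (μ : Measure X)
    (f : X → E) : eLpNorm f 2 μ ^ 2 = ∫⁻ x, ‖f x‖ₑ ^ 2 ∂μ := by
  rw [eLpNorm_eq_lintegral_rpow_enorm_toReal (by norm_num) (by norm_num), ← ENNReal.rpow_natCast,
    ← ENNReal.rpow_mul]
  norm_num

end

/-! ### Bourgain spaces as spaces of `L⁶` functions -/

section

open MeasureTheory Filter Topology

variable {α β s b : ℝ}

/-- The squared weighted `L²` norm on the Fourier side. -/
def weightedSq (α β s b : ℝ) (F : Plane → ℂ) : ℝ≥0∞ :=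
  ∫⁻ ζ, (bourgainWeight α β s b ζ * ‖F ζ‖ₑ) ^ 2

theorem weight_nonneg (α β s b x t : ℝ) : 0 ≤ weight α β s b x t :=
  mul_nonneg (Real.rpow_nonneg (bracket_pos _).le _) (Real.rpow_nonneg (bracket_pos _).le _)

theorem eLpNorm_weight_mul_sq (F : Plane → ℂ) :
    eLpNorm (fun ζ : Plane ↦
      (weight α β s b (2 * Real.pi * ζ 0) (2 * Real.pi * ζ 1) : ℂ) * F ζ) 2 volume ^ 2 =
      weightedSq α β s b F := by
  rw [eLpNorm_two_sq]
  refine lintegral_congr fun ζ ↦ ?_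
  rw [enorm_mul, bourgainWeight, ← ofReal_norm, Complex.norm_real,
    Real.norm_of_nonneg (weight_nonneg _ _ _ _ _ _)]

/-- Representatives agree almost everywhere, so the infimum is over a constant family. -/
theorem bourgainNorm_sq_eq {F : Plane → ℂ} {U : 𝓢'(Plane, ℂ)} (h : Represents F (𝓕 U)) :
    bourgainNorm α β s b U ^ 2 = weightedSq α β s b F := by
  rw [← eLpNorm_weight_mul_sq]
  congr 1
  refine le_antisymm (iInf₂_le F h) (le_iInf₂ fun F' h' ↦ le_of_eq (eLpNorm_congr_ae ?_))
  filter_upwards [h.ae_eq h'] with ζ hζ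
  rw [hζ]

theorem MemBourgain.exists_measurable {U : 𝓢'(Plane, ℂ)} (h : MemBourgain α β s b U) :
    ∃ F : Plane → ℂ, Measurable F ∧ Represents F (𝓕 U) ∧ weightedSq α β s b F < ∞ := by
  obtain ⟨F, hF⟩ : ∃ F, Represents F (𝓕 U) := by
    -- Without a representative the infimum is over an empty family and equals `∞`.
    by_contra hcon
    push Not at hcon
    refine h.ne ?_
    simp [bourgainNorm, hcon]
  refine ⟨hF.1.mk F, hF.1.stronglyMeasurable_mk.measurable, hF.congr hF.1.ae_eq_mk, ?_⟩
  rw [← bourgainNorm_sq_eq (hF.congr hF.1.ae_eq_mk)]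
  exact ENNReal.pow_lt_top h

/-- The triple convolution of the moduli. -/
def absTriple (f₁ f₂ f₃ : Plane → ℂ) : Plane → ℝ≥0∞ :=
  (fun z ↦ ‖f₁ z‖ₑ) ⋆ₗ ((fun z ↦ ‖f₂ z‖ₑ) ⋆ₗ (fun z ↦ ‖f₃ z‖ₑ))

/-- The weighted triple convolution estimate with constant `C`. -/
def ConvolutionBound (α β s b : ℝ) (C : ℝ≥0) : Prop :=
  ∀ f₁ f₂ f₃ : Plane → ℂ, Measurable f₁ → Measurable f₂ → Measurable f₃ →
    ∫⁻ ζ, (ENNReal.ofReal (bracket (2 * Real.pi * ζ 0) ^ (s + 1)) * absTriple f₁ f₂ f₃ ζ) ^ 2 ≤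
      C * (weightedSq α β s b f₁ * weightedSq α β s b f₂ * weightedSq α β s b f₃)

theorem exists_convolutionBound (α : ℝ) (hβ : β ≠ 0) (hs : -(1 / 4) ≤ s) (hb : 1 / 2 < b) :
    ∃ C : ℝ≥0, ConvolutionBound α β s b C := by
  obtain ⟨C, hC⟩ := lintegral_sq_lconvolution_plane_le α hβ hs hb
  exact ⟨C, fun f₁ f₂ f₃ h₁ h₂ h₃ ↦ hC _ _ _ h₁.enorm h₂.enorm h₃.enorm⟩

theorem ConvolutionBound.lintegral_absTriple_sq_le {C : ℝ≥0} (hC : ConvolutionBound α β s b C)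
    (hs : 0 ≤ s + 1) {f₁ f₂ f₃ : Plane → ℂ} (h₁ : Measurable f₁) (h₂ : Measurable f₂)
    (h₃ : Measurable f₃) : ∫⁻ ζ, absTriple f₁ f₂ f₃ ζ ^ 2 ≤
      C * (weightedSq α β s b f₁ * weightedSq α β s b f₂ * weightedSq α β s b f₃) := by
  refine le_trans (lintegral_mono fun ζ ↦ ?_) (hC f₁ f₂ f₃ h₁ h₂ h₃)
  gcongr
  refine le_mul_of_one_le_left' ?_
  rw [ENNReal.one_le_ofReal]
  exact Real.one_le_rpow (one_le_bracket _) hs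

theorem ConvolutionBound.memLp_tripleConvolution {C : ℝ≥0} (hC : ConvolutionBound α β s b C)
    (hs : 0 ≤ s + 1) {f₁ f₂ f₃ : Plane → ℂ} (h₁ : Measurable f₁) (h₂ : Measurable f₂)
    (h₃ : Measurable f₃) (i₁ : Integrable f₁) (i₂ : Integrable f₂) (i₃ : Integrable f₃)
    (w₁ : weightedSq α β s b f₁ < ∞) (w₂ : weightedSq α β s b f₂ < ∞)
    (w₃ : weightedSq α β s b f₃ < ∞) : MemLp (tripleConvolution f₁ f₂ f₃) 2 := by
  refine ⟨(integrable_tripleConvolution i₁ i₂ i₃).1, ?_⟩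
  have h : eLpNorm (tripleConvolution f₁ f₂ f₃) 2 volume ^ 2 < ∞ := by
    rw [eLpNorm_two_sq]
    refine lt_of_le_of_lt (lintegral_mono fun ζ ↦
      pow_le_pow_left' (enorm_tripleConvolution_le f₁ f₂ f₃ ζ) 2) ?_
    refine (hC.lintegral_absTriple_sq_le hs h₁ h₂ h₃).trans_lt ?_
    exact ENNReal.mul_lt_top ENNReal.coe_lt_top
      (ENNReal.mul_lt_top (ENNReal.mul_lt_top w₁ w₂) w₃)
  simpa using h

/-- The `L⁶` Strichartz estimate in Bourgain spaces, for functions with integrable Fourier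
transform. -/
theorem ConvolutionBound.eLpNorm_fourierInv_six_le {C : ℝ≥0} (hC : ConvolutionBound α β s b C)
    (hs : 0 ≤ s + 1) {f : Plane → ℂ} (hf : Measurable f) (hi : Integrable f)
    (hw : weightedSq α β s b f < ∞) :
    eLpNorm (𝓕⁻ f) 6 volume ^ 6 ≤ C * weightedSq α β s b f ^ 3 := by
  have hm := hC.memLp_tripleConvolution hs hf hf hf hi hi hi hw hw hw
  -- The sixth power of `|u|` is the square of `|u³|`, and `u³` is the inverse Fourier transform of
  -- a triple convolution; Plancherel then applies.
  have e1 : eLpNorm (𝓕⁻ f) 6 volume ^ 6 =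
      eLpNorm (𝓕⁻ (tripleConvolution f f f)) 2 volume ^ 2 := by
    rw [eLpNorm_two_sq, eLpNorm_eq_lintegral_rpow_enorm_toReal (by norm_num) (by norm_num),
      ← ENNReal.rpow_natCast, ← ENNReal.rpow_mul, fourierInv_tripleConvolution hi hi hi]
    norm_num
    refine lintegral_congr fun z ↦ ?_
    ring
  rw [e1, eLpNorm_fourierInv (integrable_tripleConvolution hi hi hi) hm, eLpNorm_two_sq]
  refine (lintegral_mono fun ζ ↦
      pow_le_pow_left' (enorm_tripleConvolution_le f f f ζ) 2).trans ?_
  refine (hC.lintegral_absTriple_sq_le hs hf hf hf).trans (le_of_eq ?_)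
  ring

/-- Truncation of a function to a bounded set on which it is bounded. -/
def trunc (F : Plane → ℂ) (n : ℕ) : Plane → ℂ :=
  {ζ : Plane | ‖ζ‖ ≤ n ∧ ‖F ζ‖ ≤ n}.indicator F

theorem measurableSet_trunc {F : Plane → ℂ} (hF : Measurable F) (n : ℕ) :
    MeasurableSet {ζ : Plane | ‖ζ‖ ≤ n ∧ ‖F ζ‖ ≤ n} := by
  change MeasurableSet ({ζ : Plane | ‖ζ‖ ≤ n} ∩ {ζ : Plane | ‖F ζ‖ ≤ n})
  exact (measurableSet_le (by fun_prop) (by fun_prop)).inter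
    (measurableSet_le (by fun_prop) (by fun_prop))

theorem measurable_trunc {F : Plane → ℂ} (hF : Measurable F) (n : ℕ) : Measurable (trunc F n) :=
  hF.indicator (measurableSet_trunc hF n)

theorem enorm_trunc_le (F : Plane → ℂ) (n : ℕ) (ζ : Plane) : ‖trunc F n ζ‖ₑ ≤ ‖F ζ‖ₑ :=
  enorm_indicator_le_enorm_self _ _

theorem integrable_trunc {F : Plane → ℂ} (hF : Measurable F) (n : ℕ) :
    Integrable (trunc F n) := by
  have h : Integrable ((Metric.closedBall (0 : Plane) n).indicator fun _ ↦ (n : ℝ)) :=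
    (integrable_indicator_iff measurableSet_closedBall).2
      (integrableOn_const (measure_closedBall_lt_top (μ := volume) (x := (0 : Plane)) (r := n)).ne)
  refine h.mono' (measurable_trunc hF n).aestronglyMeasurable (.of_forall fun ζ ↦ ?_)
  by_cases hζ : ‖ζ‖ ≤ n ∧ ‖F ζ‖ ≤ n
  · rw [trunc, Set.indicator_of_mem (by exact hζ), Set.indicator_of_mem (by simpa using hζ.1)]
    exact hζ.2
  · rw [trunc, Set.indicator_of_notMem (by exact hζ), norm_zero]
    exact Set.indicator_nonneg (fun _ _ ↦ by positivity) _

theorem trunc_eq_of_le {F : Plane → ℂ} {ζ : Plane} {n : ℕ} (h : ‖ζ‖ ≤ n ∧ ‖F ζ‖ ≤ n) {m : ℕ}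
    (hm : n ≤ m) : trunc F m ζ = F ζ := by
  have : (n : ℝ) ≤ m := by exact_mod_cast hm
  exact Set.indicator_of_mem (by exact ⟨h.1.trans this, h.2.trans this⟩) _

theorem eventually_trunc_eq (F : Plane → ℂ) (ζ : Plane) :
    ∀ᶠ n in atTop, ‖ζ‖ ≤ (n : ℕ) ∧ ‖F ζ‖ ≤ (n : ℕ) := by
  filter_upwards [eventually_ge_atTop ⌈max ‖ζ‖ ‖F ζ‖⌉₊] with n hn
  have := (Nat.le_ceil _).trans (by exact_mod_cast hn : ((⌈max ‖ζ‖ ‖F ζ‖⌉₊ : ℕ) : ℝ) ≤ n)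
  exact ⟨(le_max_left _ _).trans this, (le_max_right _ _).trans this⟩

theorem weightedSq_trunc_lt_top {F : Plane → ℂ} (hw : weightedSq α β s b F < ∞) (n : ℕ) :
    weightedSq α β s b (trunc F n) < ∞ := by
  refine lt_of_le_of_lt (lintegral_mono fun ζ ↦ ?_) hw
  gcongr
  exact enorm_trunc_le F n ζ

/-- Elements of Bourgain spaces are `L⁶` functions, approximated by the inverse Fourier integrals
of the truncations of their Fourier transform. -/
theorem ConvolutionBound.exists_Lp_six {C : ℝ≥0} (hC : ConvolutionBound α β s b C)
    (hs : 0 ≤ s + 1) [Fact ((1 : ℝ≥0∞) ≤ 6)] {U : 𝓢'(Plane, ℂ)} {F : Plane → ℂ} (hF : Measurable F)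
    (hU : Represents F (𝓕 U)) (hw : weightedSq α β s b F < ∞) :
    ∃ (V : Lp ℂ 6 (volume : Measure Plane)) (v : ℕ → Lp ℂ 6 (volume : Measure Plane)),
      Represents V U ∧ (∀ n, v n =ᵐ[volume] 𝓕⁻ (trunc F n)) ∧ Tendsto v atTop (𝓝 V) := by
  have hint := integrable_trunc hF
  have hmem : ∀ n, MemLp (𝓕⁻ (trunc F n)) 6 := fun n ↦ by
    refine ⟨(continuous_fourierInv (hint n)).aestronglyMeasurable, ?_⟩
    have h1 := hC.eLpNorm_fourierInv_six_le hs (measurable_trunc hF n) (hint n)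
      (weightedSq_trunc_lt_top hw n)
    have h2 : eLpNorm (𝓕⁻ (trunc F n)) 6 volume ^ 6 < ∞ := h1.trans_lt
      (ENNReal.mul_lt_top ENNReal.coe_lt_top (ENNReal.pow_lt_top (weightedSq_trunc_lt_top hw n)))
    simpa using h2
  set v : ℕ → Lp ℂ 6 (volume : Measure Plane) := fun n ↦ (hmem n).toLp
  -- Beyond index `N` the truncations differ only off the `N`-th truncation set, and there by at
  -- most `|F|`. Thus `tail` controls the Cauchy property and tends to zero by dominated
  -- convergence.
  set tail : ℕ → ℝ≥0∞ := fun N ↦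
    weightedSq α β s b ({ζ : Plane | ‖ζ‖ ≤ N ∧ ‖F ζ‖ ≤ N}ᶜ.indicator F) with htail
  have hsub : ∀ {N n m : ℕ}, N ≤ n → N ≤ m →
      weightedSq α β s b (fun ζ ↦ trunc F n ζ - trunc F m ζ) ≤ tail N := by
    intro N n m hn hm
    refine lintegral_mono fun ζ ↦ ?_
    gcongr
    by_cases hζ : ‖ζ‖ ≤ N ∧ ‖F ζ‖ ≤ N
    · dsimp only
      rw [trunc_eq_of_le hζ hn, trunc_eq_of_le hζ hm]; simp
    · rw [Set.indicator_of_mem (by exact hζ)]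
      simp only [trunc, Set.indicator]
      split_ifs <;> simp
  have htail0 : Tendsto tail atTop (𝓝 0) := by
    have h0 : (0 : ℝ≥0∞) = ∫⁻ _ : Plane, 0 := by simp
    rw [h0]
    refine tendsto_lintegral_of_dominated_convergence
      (fun ζ ↦ (bourgainWeight α β s b ζ * ‖F ζ‖ₑ) ^ 2) (fun N ↦ ?_) (fun N ↦ .of_forall fun ζ ↦ ?_)
      hw.ne (.of_forall fun ζ ↦ ?_)
    · have := hF.indicator (measurableSet_trunc hF N).compl
      fun_prop
    · exact pow_le_pow_left' (mul_le_mul_right (enorm_indicator_le_enorm_self _ _) _) 2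
    · refine tendsto_const_nhds.congr' ?_
      filter_upwards [eventually_trunc_eq F ζ] with N hN
      rw [Set.indicator_of_notMem (by simpa using hN)]
      simp
  have hcauchy : CauchySeq v := by
    refine EMetric.cauchySeq_iff_le_tendsto_0.2
      ⟨fun N ↦ (C * tail N ^ 3) ^ (1 / 6 : ℝ), fun n m N hn hm ↦ ?_, ?_⟩
    · rw [Lp.edist_toLp_toLp]
      have e1 : 𝓕⁻ (trunc F n) - 𝓕⁻ (trunc F m) = 𝓕⁻ (fun ζ ↦ trunc F n ζ - trunc F m ζ) := by
        ext z
        rw [Pi.sub_apply, Real.fourierInv_eq, Real.fourierInv_eq, Real.fourierInv_eq,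
          ← integral_sub]
        · simp_rw [smul_sub]
        · simpa using (Real.fourierIntegral_convergent_iff (-z)).2 (hint n)
        · simpa using (Real.fourierIntegral_convergent_iff (-z)).2 (hint m)
      have hlt : weightedSq α β s b (fun ζ ↦ trunc F n ζ - trunc F m ζ) < ∞ := by
        refine (hsub (Nat.zero_le n) (Nat.zero_le m)).trans_lt (lt_of_le_of_lt ?_ hw)
        refine lintegral_mono fun ζ ↦ ?_
        gcongr
        exact enorm_indicator_le_enorm_self _ _
      have h1 := hC.eLpNorm_fourierInv_six_le hs
        ((measurable_trunc hF n).sub (measurable_trunc hF m)) ((hint n).sub (hint m)) hlt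
      rw [e1]
      have h2 : eLpNorm (𝓕⁻ (fun ζ ↦ trunc F n ζ - trunc F m ζ)) 6 volume ^ 6 ≤ C * tail N ^ 3 :=
        h1.trans (by gcongr; exact hsub hn hm)
      have h3 := ENNReal.rpow_le_rpow h2 (by norm_num : (0 : ℝ) ≤ 1 / 6)
      rw [← ENNReal.rpow_natCast, ← ENNReal.rpow_mul] at h3
      norm_num only [Nat.cast_ofNat, ENNReal.rpow_one, mul_one] at h3
      exact h3
    · have h1 : Tendsto (fun N ↦ C * tail N ^ 3) atTop (𝓝 (C * 0 ^ 3)) :=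
        ENNReal.Tendsto.const_mul (ENNReal.Tendsto.pow htail0) (Or.inr ENNReal.coe_ne_top)
      have h2 := h1.ennrpow_const (1 / 6 : ℝ)
      simpa using h2
  obtain ⟨V, hV⟩ := cauchySeq_tendsto_of_complete hcauchy
  refine ⟨V, v, ?_, fun n ↦ (hmem n).coeFn_toLp, hV⟩
  -- The `L⁶` limit is identified with `U` by testing against `φ`: on the Fourier side the pairings
  -- converge by dominated convergence.
  have hUV : U = Lp.toTemperedDistribution V := by
    ext φ
    have t1 : Tendsto (fun n ↦ Lp.toTemperedDistribution (v n) φ) atTop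
        (𝓝 (Lp.toTemperedDistribution V φ)) := by
      have hc := (Lp.toTemperedDistributionCLM ℂ (volume : Measure Plane) 6).continuous
      have he : Continuous fun T : 𝓢'(Plane, ℂ) ↦ T φ :=
        (PointwiseConvergenceCLM.evalCLM (RingHom.id ℂ) ℂ φ).continuous
      exact ((he.comp hc).tendsto V).comp hV
    have t2 : Tendsto (fun n ↦ ∫ z, (𝓕⁻ φ : 𝓢(Plane, ℂ)) z * trunc F n z) atTop
        (𝓝 (∫ z, (𝓕⁻ φ : 𝓢(Plane, ℂ)) z * F z)) := by
      refine tendsto_integral_of_dominated_convergence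
        (fun z ↦ ‖(𝓕⁻ φ : 𝓢(Plane, ℂ)) z * F z‖) (fun n ↦ ?_) (hU.2 (𝓕⁻ φ)).1.norm
        (fun n ↦ .of_forall fun z ↦ ?_) (.of_forall fun z ↦ ?_)
      · exact ((𝓕⁻ φ : 𝓢(Plane, ℂ)).continuous.measurable.mul
          (measurable_trunc hF n)).aestronglyMeasurable
      · rw [norm_mul, norm_mul]
        gcongr
        exact norm_indicator_le_norm_self _ _
      · refine tendsto_const_nhds.congr' ?_
        filter_upwards [eventually_trunc_eq F z] with n hn
        rw [trunc_eq_of_le hn le_rfl]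
    have e : ∀ n, Lp.toTemperedDistribution (v n) φ =
        ∫ z, (𝓕⁻ φ : 𝓢(Plane, ℂ)) z * trunc F n z := fun n ↦ by
      rw [Lp.toTemperedDistribution_apply, SchwartzMap.fourierInv_coe,
        ← integral_mul_fourierInv_eq (hint n) φ.integrable]
      refine integral_congr_ae ?_
      filter_upwards [(hmem n).coeFn_toLp] with z hz
      simp only [v]
      rw [hz, smul_eq_mul]
    simp only [e] at t1
    have h1 := tendsto_nhds_unique t1 t2
    rw [h1, ← (hU.2 (𝓕⁻ φ)).2, TemperedDistribution.fourier_apply,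
      FourierTransform.fourier_fourierInv_eq]
  rw [hUV]
  exact represents_toTemperedDistribution V

end

/-! ### The product of three elements and its derivative -/

section

open MeasureTheory Filter Topology

variable {α β s b : ℝ}

theorem absTriple_trunc_le (F₁ F₂ F₃ : Plane → ℂ) (n : ℕ) (ζ : Plane) :
    absTriple (trunc F₁ n) (trunc F₂ n) (trunc F₃ n) ζ ≤ absTriple F₁ F₂ F₃ ζ :=
  lconvolution_mono (enorm_trunc_le F₁ n)
    (lconvolution_mono (enorm_trunc_le F₂ n) (enorm_trunc_le F₃ n)) ζ

/-- A pointwise bound that holds almost everywhere along an `Lᵖ`-convergent sequence passes to the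
limit. -/
theorem ae_enorm_le_of_tendsto_Lp {X E : Type*} [MeasurableSpace X] [NormedAddCommGroup E]
    {μ : Measure X} {p : ℝ≥0∞} [Fact (1 ≤ p)] {T : ℕ → Lp E p μ} {T' : Lp E p μ}
    (h : Tendsto T atTop (𝓝 T')) {K : X → ℝ≥0∞} (hK : ∀ n, ∀ᵐ x ∂μ, ‖T n x‖ₑ ≤ K x) :
    ∀ᵐ x ∂μ, ‖T' x‖ₑ ≤ K x := by
  obtain ⟨k, -, hk⟩ := (tendstoInMeasure_of_tendsto_Lp h).exists_seq_tendsto_ae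
  filter_upwards [hk, ae_all_iff.2 hK] with x hx hx'
  exact le_of_tendsto hx.enorm (.of_forall fun n ↦ hx' _)

/-- Multiplication of three functions is continuous from `L⁶ × L⁶ × L⁶` to `L²`. -/
theorem exists_tendsto_mul_Lp {X : Type*} [MeasurableSpace X] {μ : Measure X}
    [Fact ((1 : ℝ≥0∞) ≤ 6)] {v₁ v₂ v₃ : ℕ → Lp ℂ 6 μ} {V₁ V₂ V₃ : Lp ℂ 6 μ}
    (t₁ : Tendsto v₁ atTop (𝓝 V₁)) (t₂ : Tendsto v₂ atTop (𝓝 V₂))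
    (t₃ : Tendsto v₃ atTop (𝓝 V₃)) :
    ∃ (T : ℕ → Lp ℂ 2 μ) (T' : Lp ℂ 2 μ), (∀ n, T n =ᵐ[μ] fun z ↦ v₁ n z * v₂ n z * v₃ n z) ∧
      (T' =ᵐ[μ] fun z ↦ V₁ z * V₂ z * V₃ z) ∧ Tendsto T atTop (𝓝 T') := by
  have : Fact ((1 : ℝ≥0∞) ≤ 3) := ⟨by norm_num⟩
  have : ENNReal.HolderTriple 6 6 3 := ⟨by
    rw [← ENNReal.toReal_eq_toReal_iff' (by simp) (by simp), ENNReal.toReal_add (by simp) (by simp)]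
    norm_num⟩
  have : ENNReal.HolderTriple 3 6 2 := ⟨by
    rw [← ENNReal.toReal_eq_toReal_iff' (by simp) (by simp), ENNReal.toReal_add (by simp) (by simp)]
    norm_num⟩
  let L₁ := (ContinuousLinearMap.mul ℂ ℂ).holderL μ 6 6 3
  let L₂ := (ContinuousLinearMap.mul ℂ ℂ).holderL μ 3 6 2
  have hL (f g h : Lp ℂ 6 μ) : L₂ (L₁ f g) h =ᵐ[μ] fun z ↦ f z * g z * h z := by
    simp only [L₁, L₂, ContinuousLinearMap.holderL_apply_apply]
    filter_upwards [(ContinuousLinearMap.mul ℂ ℂ).coeFn_holder (r := 2)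
      ((ContinuousLinearMap.mul ℂ ℂ).holder 3 f g) h,
      (ContinuousLinearMap.mul ℂ ℂ).coeFn_holder (r := 3) f g] with z hz hz'
    rw [hz, hz', ContinuousLinearMap.mul_apply', ContinuousLinearMap.mul_apply']
  clear_value L₁ L₂
  exact ⟨fun n ↦ L₂ (L₁ (v₁ n) (v₂ n)) (v₃ n), L₂ (L₁ V₁ V₂) V₃,
    fun n ↦ hL (v₁ n) (v₂ n) (v₃ n), hL V₁ V₂ V₃,
    (L₂.continuous₂.tendsto (L₁ V₁ V₂, V₃)).comp
      (((L₁.continuous₂.tendsto (V₁, V₂)).comp (t₁.prodMk_nhds t₂)).prodMk_nhds t₃)⟩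

/-- The product of three elements of a Bourgain space is in `L²`, and its Fourier transform is
bounded by the triple convolution of the moduli of the Fourier transforms. -/
theorem ConvolutionBound.exists_product {C : ℝ≥0} (hC : ConvolutionBound α β s b C)
    (hs : 0 ≤ s + 1) {U₁ U₂ U₃ : 𝓢'(Plane, ℂ)} {F₁ F₂ F₃ : Plane → ℂ}
    (h₁ : Measurable F₁) (h₂ : Measurable F₂) (h₃ : Measurable F₃)
    (r₁ : Represents F₁ (𝓕 U₁)) (r₂ : Represents F₂ (𝓕 U₂)) (r₃ : Represents F₃ (𝓕 U₃))
    (w₁ : weightedSq α β s b F₁ < ∞) (w₂ : weightedSq α β s b F₂ < ∞)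
    (w₃ : weightedSq α β s b F₃ < ∞) :
    ∃ (u₁ u₂ u₃ : Plane → ℂ) (T : Lp ℂ 2 (volume : Measure Plane)),
      Represents u₁ U₁ ∧ Represents u₂ U₂ ∧ Represents u₃ U₃ ∧
      (T =ᵐ[volume] fun z ↦ u₁ z * u₂ z * u₃ z) ∧
      ∀ᵐ ζ, ‖(𝓕 T : Lp ℂ 2 (volume : Measure Plane)) ζ‖ₑ ≤ absTriple F₁ F₂ F₃ ζ := by
  have : Fact ((1 : ℝ≥0∞) ≤ 6) := ⟨by norm_num⟩
  obtain ⟨V₁, v₁, hV₁, hv₁, t₁⟩ := hC.exists_Lp_six hs h₁ r₁ w₁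
  obtain ⟨V₂, v₂, hV₂, hv₂, t₂⟩ := hC.exists_Lp_six hs h₂ r₂ w₂
  obtain ⟨V₃, v₃, hV₃, hv₃, t₃⟩ := hC.exists_Lp_six hs h₃ r₃ w₃
  obtain ⟨T, T', hT, hT', ht⟩ := exists_tendsto_mul_Lp t₁ t₂ t₃
  refine ⟨V₁, V₂, V₃, T', hV₁, hV₂, hV₃, hT', ?_⟩
  have htF : Tendsto (fun n ↦ 𝓕 (T n)) atTop (𝓝 (𝓕 T')) :=
    ((FourierTransform.fourierCLM ℂ (Lp ℂ 2 (volume : Measure Plane))).continuous.tendsto _).comp ht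
  -- The Fourier transform of a product of truncations is a genuine triple convolution, dominated by
  -- `absTriple F₁ F₂ F₃` uniformly in `n`.
  refine ae_enorm_le_of_tendsto_Lp htF fun n ↦ ?_
  have i₁ := integrable_trunc h₁ n
  have i₂ := integrable_trunc h₂ n
  have i₃ := integrable_trunc h₃ n
  have hi := integrable_tripleConvolution i₁ i₂ i₃
  have hm := hC.memLp_tripleConvolution hs (measurable_trunc h₁ n) (measurable_trunc h₂ n)
    (measurable_trunc h₃ n) i₁ i₂ i₃ (weightedSq_trunc_lt_top w₁ n)
    (weightedSq_trunc_lt_top w₂ n) (weightedSq_trunc_lt_top w₃ n)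
  have e : T n = (memLp_fourierInv hi hm).toLp _ := by
    refine Lp.ext ?_
    filter_upwards [hT n, (memLp_fourierInv hi hm).coeFn_toLp, hv₁ n, hv₂ n,
      hv₃ n] with z e₀ e₁ e₂ e₃ e₄
    rw [e₀, e₁, e₂, e₃, e₄, fourierInv_tripleConvolution i₁ i₂ i₃]
  rw [e, fourier_toLp_fourierInv hi hm]
  filter_upwards [hm.coeFn_toLp] with ζ hζ
  rw [hζ]
  exact (enorm_tripleConvolution_le _ _ _ ζ).trans (absTriple_trunc_le F₁ F₂ F₃ n ζ)

/-- On the Fourier side, differentiation in `x` is multiplication by `2πi ζ₀`. -/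
theorem Represents.fourier_lineDeriv {P : 𝓢'(Plane, ℂ)} {G : Plane → ℂ}
    (h : Represents G (𝓕 P)) :
    Represents (fun ζ ↦ (2 * Real.pi * Complex.I) * ((ζ 0 : ℝ) * G ζ)) (𝓕 (∂_{ex} P)) := by
  have hg : (fun z : Plane ↦ ((inner ℝ z ex : ℝ) : ℂ)).HasTemperateGrowth := by fun_prop
  have hin (z : Plane) : inner ℝ z ex = z 0 := by
    simp [ex, EuclideanSpace.inner_single_right]
  have e (φ : 𝓢(Plane, ℂ)) : (fun z ↦ φ z * (2 * Real.pi * Complex.I * ((z 0 : ℝ) * G z))) =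
      fun z ↦ (2 * Real.pi * Complex.I) *
        (SchwartzMap.smulLeftCLM ℂ (fun z : Plane ↦ ((inner ℝ z ex : ℝ) : ℂ)) φ z * G z) := by
    ext z
    rw [SchwartzMap.smulLeftCLM_apply_apply hg, hin, smul_eq_mul]
    ring
  refine ⟨?_, fun φ ↦ ?_⟩
  · have : AEStronglyMeasurable (fun ζ : Plane ↦ ((ζ 0 : ℝ) : ℂ)) :=
      Measurable.aestronglyMeasurable (by fun_prop)
    exact (this.mul h.1).const_mul _
  · rw [e]
    refine ⟨(h.2 _).1.const_mul _, ?_⟩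
    rw [integral_const_mul, ← (h.2 _).2, TemperedDistribution.fourier_lineDerivOp_eq]
    rfl

/-- The angular frequency `ξ` produced by the derivative is absorbed into `⟨ξ⟩ ^ (s + 1)`, and the
modulation factor is discarded because `b - 1 ≤ 0`. -/
theorem weightedSq_lineDeriv_le (hb1 : b ≤ 1) (G : Plane → ℂ) :
    weightedSq α β s (b - 1) (fun ζ ↦ (2 * Real.pi * Complex.I) * ((ζ 0 : ℝ) * G ζ)) ≤
      ∫⁻ ζ, (ENNReal.ofReal (bracket (2 * Real.pi * ζ 0) ^ (s + 1)) * ‖G ζ‖ₑ) ^ 2 := by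
  refine lintegral_mono fun ζ ↦ pow_le_pow_left' ?_ 2
  set x := 2 * Real.pi * ζ 0 with hx
  have e : ‖(2 * Real.pi * Complex.I) * ((ζ 0 : ℝ) * G ζ)‖ₑ = ENNReal.ofReal |x| * ‖G ζ‖ₑ := by
    rw [← mul_assoc, enorm_mul]
    congr 1
    rw [← ofReal_norm]
    congr 1
    simp [hx, abs_mul, abs_of_pos Real.pi_pos]
  dsimp only
  rw [e, ← mul_assoc, bourgainWeight, ← ENNReal.ofReal_mul (weight_nonneg _ _ _ _ _ _)]
  gcongr
  rw [← hx, weight, Real.rpow_add (bracket_pos _), Real.rpow_one]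
  have h0 := (Real.rpow_pos_of_pos (bracket_pos x) s).le
  have h1 : bracket (2 * Real.pi * ζ 1 - phase α β x) ^ (b - 1) ≤ 1 :=
    Real.rpow_le_one_of_one_le_of_nonpos (one_le_bracket _) (by linarith)
  have h2 : |x| ≤ bracket x := by unfold bracket; linarith
  exact mul_le_mul (mul_le_of_le_one_right h0 h1) h2 (abs_nonneg _) h0

end

end Kawahara

end

theorem lemma5p1 (α β : ℝ) (hβ : β ≠ 0) (s b : ℝ) (hs : -(1 / 4) ≤ s) (hb : 1 / 2 < b)
    (hb1 : b ≤ 1) :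
    ∃ C : ℝ≥0, ∀ U₁ U₂ U₃ : 𝓢'(Kawahara.Plane, ℂ),
      Kawahara.MemBourgain α β s b U₁ → Kawahara.MemBourgain α β s b U₂ →
      Kawahara.MemBourgain α β s b U₃ →
      ∃ (u₁ u₂ u₃ : Kawahara.Plane → ℂ) (P : 𝓢'(Kawahara.Plane, ℂ)),
        Kawahara.Represents u₁ U₁ ∧ Kawahara.Represents u₂ U₂ ∧ Kawahara.Represents u₃ U₃ ∧
        Kawahara.Represents (fun z ↦ u₁ z * u₂ z * u₃ z) P ∧
        Kawahara.bourgainNorm α β s (b - 1) (∂_{Kawahara.ex} P) ≤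
          C * Kawahara.bourgainNorm α β s b U₁ * Kawahara.bourgainNorm α β s b U₂ *
            Kawahara.bourgainNorm α β s b U₃ := by
  obtain ⟨C, hC⟩ := Kawahara.exists_convolutionBound α hβ hs hb
  -- `C` bounds squared norms, whence the square root.
  refine ⟨NNReal.sqrt C, fun U₁ U₂ U₃ m₁ m₂ m₃ ↦ ?_⟩
  obtain ⟨F₁, h₁, r₁, w₁⟩ := m₁.exists_measurable
  obtain ⟨F₂, h₂, r₂, w₂⟩ := m₂.exists_measurable
  obtain ⟨F₃, h₃, r₃, w₃⟩ := m₃.exists_measurable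
  obtain ⟨u₁, u₂, u₃, T, hu₁, hu₂, hu₃, hT, hle⟩ :=
    hC.exists_product (by linarith) h₁ h₂ h₃ r₁ r₂ r₃ w₁ w₂ w₃
  refine ⟨u₁, u₂, u₃, MeasureTheory.Lp.toTemperedDistribution T, hu₁, hu₂, hu₃,
    (Kawahara.represents_toTemperedDistribution T).congr hT, ?_⟩
  have hF := Kawahara.represents_toTemperedDistribution (𝓕 T)
  rw [← MeasureTheory.Lp.fourier_toTemperedDistribution_eq] at hF
  rw [← ENNReal.pow_le_pow_left_iff two_ne_zero, mul_pow, mul_pow, mul_pow,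
    Kawahara.bourgainNorm_sq_eq hF.fourier_lineDeriv, Kawahara.bourgainNorm_sq_eq r₁,
    Kawahara.bourgainNorm_sq_eq r₂, Kawahara.bourgainNorm_sq_eq r₃, ← ENNReal.coe_pow,
    NNReal.sq_sqrt]
  refine (Kawahara.weightedSq_lineDeriv_le hb1 _).trans
    (le_trans ?_ ((hC F₁ F₂ F₃ h₁ h₂ h₃).trans_eq (by ring)))
  refine MeasureTheory.lintegral_mono_ae ?_
  filter_upwards [hle] with ζ hζ
  gcongr
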